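/- Let $\mathrm{St}(n,r)=\{X\in\mathbb{R}^{n\times r}: X^\top X=I_r\}$, with $\mathbb{R}^{n\times r}$ carrying the Frobenius inner product $\langle X,Y\rangle=\mathrm{tr}(X^\top Y)$ and norm, and with tangent spaces $T_X=\{V: V^\top X+X^\top V=0\}$. Let $\mathbf{R}$ be a retraction on $\mathrm{St}(n,r)$: a smooth map from the tangent bundle to $\mathrm{St}(n,r)$ with $\mathbf{R}_X(0)=X$ and $\mathrm{D}\mathbf{R}_X(0)=\mathrm{id}_{T_X}$. Let $M_2>0$ be such that $\|\mathbf{R}_X(\xi)-X-\xi\|\le M_2\|\xi\|^2$ for all $X\in \mathrm{St}(n,r)$, $\xi\in T_X$. Let $f,h:\mathbb{R}^{n\times r}\to\mathbb{R}$ and $F=f+h$. **Algorithm (ARPQN).** Parameters: $\sigma_0>0$, $\sigma,\gamma\in(0,1)$, $0<\eta_1<\eta_2<1$, $0<\gamma_1<1<\gamma_2$, an integer $m\ge0$, and $X_0\in\mathrm{St}(n,r)$. For $k=0,1,\dots$ a linear operator $\mathcal{B}_k$ on $T_{X_k}$ is chosen ($\mathcal{B}_0=I$; for $k\ge1$ by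 any update rule), and the following pass is repeated: 1. compute a minimizer $V_k$ over $T_{X_k}$ of $$\phi_k(V)=\langle\nabla f(X_k),V\rangle+\tfrac12\langle(\mathcal{B}_k+\sigma_kI)[V],V\rangle+h(X_k+V);$$ 2. set $\alpha_k=\gamma^{N}$ with the smallest integer $N\ge0$ such that $$F(\mathbf{R}_{X_k}(\alpha_kV_k))\le F(X_{l(k)})-\tfrac12\sigma\alpha_k\langle\mathcal{B}_k[V_k],V_k\rangle,$$ where $l(k)$ is an index $j$ maximizing $F(X_j)$ over $\max\{0,k-m\}\le j\le k$; 3. compute $$\rho_k=\frac{F(\mathbf{R}_{X_k}(\alpha_kV_k))-F(X_{l(k)})}{\phi_k(\alpha_kV_k)-\phi_k(0)};$$ 4. if $\rho_k<\eta_1$, replace $\sigma_k$ by $\gamma_2\sigma_k$ and repeat from step 1; if $\rho_k\ge\eta_1$, replace $\sigma_k$ by $\gamma_1\sigma_k$ in case $\rho_k\ge\eta_2$, then set $X_{k+1}=\mathbf{R}_{X_k}(\alpha_kV_k)$, $\sigma_{k+1}=\sigma_k$ and go on to $k+1$. **Theorem.** Let $\{X_k\}$ be generated by the algorithm, and suppose: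 * $f$ is continuously differentiable and $\nabla f$ is Lipschitz continuous (with some constant $L$); * $h$ is convex (not necessarily smooth) and Lipschitz continuous with constant $L_h$; * there are $0<\kappa_1<\kappa_2$ with $\kappa_1\|V\|^2\le\langle\mathcal{B}_k[V],V\rangle\le\kappa_2\|V\|^2$ for all $k\ge0$ and $V\in T_{X_k}$; * the computed solutions $V_k$ of the subproblems are all nonzero; * $f$ is twice continuously differentiable, and $\{X_k\}$ has an accumulation point $X^*$ with $\lambda_{\min}(\mathrm{Hess}(f\circ\mathbf{R}_{X^*})(0_{X^*}))\ge\delta$ for some $\delta>5L_hM_2$. Then $X_k\to X^*$, and there exist an integer $K>0$ and $\tau\in(0,1)$ such that $$F(X_k)-F(X^*)\le\tau^{k-K}\big(F(X_{l(K)})-F(X^*)\big)\qquad\text{for all } k\ge K.$$ -/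

import Mathlib

open scoped NNReal Topology ContDiff

noncomputable section

namespace ARPQN

/-- The space of real `n × r` matrices with the Frobenius inner product and norm. -/
abbrev MatSpace (n r : ℕ) : Type := EuclideanSpace ℝ (Fin n × Fin r)

/-- The matrix whose entries are the coordinates of `X`. -/
def toMat {n r : ℕ} (X : MatSpace n r) : Matrix (Fin n) (Fin r) ℝ :=
  Matrix.of fun i j => X (i, j)

theorem toMat_add {n r : ℕ} (X Y : MatSpace n r) : toMat (X + Y) = toMat X + toMat Y := rfl

theorem toMat_smul {n r : ℕ} (c : ℝ) (X : MatSpace n r) : toMat (c • X) = c • toMat X := rfl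

theorem toMat_zero {n r : ℕ} : toMat (0 : MatSpace n r) = 0 := rfl

/-- The inner product of `MatSpace n r` is `tr (Xᵀ Y)`. -/
theorem inner_eq_trace {n r : ℕ} (X Y : MatSpace n r) :
    inner ℝ X Y = ((toMat X).transpose * toMat Y).trace := by
  simp only [PiLp.inner_apply, Fintype.sum_prod_type, Matrix.trace, Matrix.diag_apply,
    Matrix.mul_apply, Matrix.transpose_apply, toMat, Matrix.of_apply]
  rw [Finset.sum_comm]
  simp [mul_comm]

/-- The Stiefel manifold `St(n, r) = {X : Xᵀ X = I}`. -/
def stiefel (n r : ℕ) : Set (MatSpace n r) :=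
  {X | (toMat X).transpose * toMat X = 1}

/-- The tangent space `{V : Vᵀ X + Xᵀ V = 0}` of the Stiefel manifold at `X`. -/
def tangentSpace {n r : ℕ} (X : MatSpace n r) : Submodule ℝ (MatSpace n r) where
  carrier := {V | (toMat V).transpose * toMat X + (toMat X).transpose * toMat V = 0}
  zero_mem' := by simp [toMat_zero]
  add_mem' := by
    intro V W hV hW
    simp only [Set.mem_ofPred_eq, toMat_add, Matrix.transpose_add, Matrix.add_mul,
      Matrix.mul_add] at hV hW ⊢
    rw [add_add_add_comm, hV, hW, add_zero]
  smul_mem' := by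
    intro c V hV
    simp only [Set.mem_ofPred_eq, toMat_smul, Matrix.transpose_smul, Matrix.smul_mul,
      Matrix.mul_smul] at hV ⊢
    rw [← smul_add, hV, smul_zero]

/-- The tangent bundle of the Stiefel manifold, as a subset of `MatSpace n r × MatSpace n r`. -/
def tangentBundle (n r : ℕ) : Set (MatSpace n r × MatSpace n r) :=
  {p | p.1 ∈ stiefel n r ∧ p.2 ∈ tangentSpace p.1}

/-- `R X ξ = R_X(ξ)` is a retraction on the Stiefel manifold. Only the values of `R` on the
tangent bundle matter. The tangent bundle is an embedded submanifold, so `ContDiffOn ℝ ∞` on it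
is smoothness as a map of manifolds. -/
structure IsRetraction {n r : ℕ} (R : MatSpace n r → MatSpace n r → MatSpace n r) : Prop where
  mapsTo : ∀ X ∈ stiefel n r, ∀ ξ ∈ tangentSpace X, R X ξ ∈ stiefel n r
  smooth : ContDiffOn ℝ ∞ (fun p : MatSpace n r × MatSpace n r => R p.1 p.2) (tangentBundle n r)
  map_zero : ∀ X ∈ stiefel n r, R X 0 = X
  deriv_zero : ∀ X ∈ stiefel n r,
    HasFDerivAt (fun ξ : tangentSpace X => R X (ξ : MatSpace n r)) (tangentSpace X).subtypeL 0

/-- The Hessian at `x` of a real function on a finite-dimensional Euclidean space, as a linear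
operator: the derivative of the gradient. -/
def hessian {E : Type*} [NormedAddCommGroup E] [InnerProductSpace ℝ E] [CompleteSpace E]
    (g : E → ℝ) (x : E) : E →L[ℝ] E :=
  fderiv ℝ (gradient g) x

/-- `λ_min(A) ≥ δ`: every eigenvalue of `A` is at least `δ`. -/
def LambdaMinGE {E : Type*} [NormedAddCommGroup E] [InnerProductSpace ℝ E]
    (A : E →L[ℝ] E) (δ : ℝ) : Prop :=
  ∀ μ : ℝ, Module.End.HasEigenvalue (A : E →ₗ[ℝ] E) μ → δ ≤ μ

/-- The input parameters of the algorithm; `memory` is the length `m` of the nonmonotone line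
search, and `lsσ`, `lsγ` are the line-search parameters `σ`, `γ`. -/
structure Params where
  σ₀ : ℝ
  lsσ : ℝ
  lsγ : ℝ
  η₁ : ℝ
  η₂ : ℝ
  γ₁ : ℝ
  γ₂ : ℝ
  memory : ℕ
  σ₀_pos : 0 < σ₀
  lsσ_pos : 0 < lsσ
  lsσ_lt_one : lsσ < 1
  lsγ_pos : 0 < lsγ
  lsγ_lt_one : lsγ < 1
  η₁_pos : 0 < η₁
  η₁_lt_η₂ : η₁ < η₂
  η₂_lt_one : η₂ < 1
  γ₁_pos : 0 < γ₁
  γ₁_lt_one : γ₁ < 1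
  one_lt_γ₂ : 1 < γ₂

/-- `max_{max{0, k - m} ≤ j ≤ k} F(X_j)`, that is `F(X_{l(k)})`. -/
def windowMax {n r : ℕ} (F : MatSpace n r → ℝ) (X : ℕ → MatSpace n r) (m k : ℕ) : ℝ :=
  (Finset.Icc (k - m) k).sup' (Finset.nonempty_Icc.mpr (Nat.sub_le k m)) fun j => F (X j)

/-- The model
`φ(V) = ⟨∇f(X), V⟩ + (1/2) ⟨(B + σ I)[V], V⟩ + h(X + V)` on the tangent space at `X`. -/
def model {n r : ℕ} (f h : MatSpace n r → ℝ) (X : MatSpace n r)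
    (B : tangentSpace X →ₗ[ℝ] tangentSpace X) (σ : ℝ) (V : tangentSpace X) : ℝ :=
  inner ℝ (gradient f X) (V : MatSpace n r)
    + 1 / 2 * inner ℝ
        ((B + σ • (LinearMap.id : tangentSpace X →ₗ[ℝ] tangentSpace X)) V) V
    + h (X + (V : MatSpace n r))

/-- The quantities that occur in a run of the algorithm. The index `k` counts outer iterations,
the index `i` counts the passes (from `0`) through the inner loop of outer iteration `k`. -/
structure Trace (n r : ℕ) where
  /-- the iterate `X_k` -/
  X : ℕ → MatSpace n r
  /-- the operator `B_k` on the tangent space at `X_k` -/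
  B : (k : ℕ) → tangentSpace (X k) →ₗ[ℝ] tangentSpace (X k)
  /-- the regularization parameter with which outer iteration `k` starts -/
  σ : ℕ → ℝ
  /-- the search direction computed in pass `i` -/
  V : (k : ℕ) → ℕ → tangentSpace (X k)
  /-- the stepsize computed in pass `i` -/
  α : ℕ → ℕ → ℝ

namespace Trace

variable {n r : ℕ}

/-- The regularization parameter in pass `i` of outer iteration `k`: every rejected pass
multiplies it by `γ₂`. -/
def reg (s : Trace n r) (P : Params) (k i : ℕ) : ℝ := P.γ₂ ^ i * s.σ k

/-- The model `φ_k` as it stands in pass `i` of outer iteration `k`. -/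
def phi (s : Trace n r) (P : Params) (f h : MatSpace n r → ℝ) (k i : ℕ) :
    tangentSpace (s.X k) → ℝ :=
  model f h (s.X k) (s.B k) (s.reg P k i)

/-- `R_{X_k}(a V)`, where `V` is the direction of pass `i`. -/
def trial (s : Trace n r) (R : MatSpace n r → MatSpace n r → MatSpace n r) (k i : ℕ) (a : ℝ) :
    MatSpace n r :=
  R (s.X k) (a • (s.V k i : MatSpace n r))

/-- The nonmonotone line-search condition for the stepsize `a`. -/
def LineSearch (s : Trace n r) (P : Params) (f h : MatSpace n r → ℝ)
    (R : MatSpace n r → MatSpace n r → MatSpace n r) (k i : ℕ) (a : ℝ) : Prop :=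
  (f + h) (s.trial R k i a) ≤ windowMax (f + h) s.X P.memory k
    - 1 / 2 * P.lsσ * a * inner ℝ (s.B k (s.V k i)) (s.V k i)

/-- The ratio `ρ_k` computed in pass `i`. -/
def ratio (s : Trace n r) (P : Params) (f h : MatSpace n r → ℝ)
    (R : MatSpace n r → MatSpace n r → MatSpace n r) (k i : ℕ) : ℝ :=
  ((f + h) (s.trial R k i (s.α k i)) - windowMax (f + h) s.X P.memory k) /
    (s.phi P f h k i (s.α k i • s.V k i) - s.phi P f h k i 0)

/-- Pass `i` of the inner loop of outer iteration `k` is executed: all earlier passes were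
rejected. -/
def Reached (s : Trace n r) (P : Params) (f h : MatSpace n r → ℝ)
    (R : MatSpace n r → MatSpace n r → MatSpace n r) (k i : ℕ) : Prop :=
  ∀ j < i, s.ratio P f h R k j < P.η₁

end Trace

/-- `s` is a run of the algorithm. The rules for the two inner loops only say what happens when
a loop is left; that the loops are left after finitely many steps is not part of the definition.
For `k ≥ 1` the operator `B k` may come from any update formula. -/
structure IsRun {n r : ℕ} (P : Params) (f h : MatSpace n r → ℝ)
    (R : MatSpace n r → MatSpace n r → MatSpace n r) (s : Trace n r) : Prop where
  init_mem : s.X 0 ∈ stiefel n r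
  init_B : s.B 0 = LinearMap.id
  init_σ : s.σ 0 = P.σ₀
  /-- In each executed pass the direction solves the subproblem. -/
  solve : ∀ k i, s.Reached P f h R k i → ∀ W, s.phi P f h k i (s.V k i) ≤ s.phi P f h k i W
  /-- Backtracking: the stepsize is `γ ^ N` for the least `N` passing the line-search test. -/
  stepsize : ∀ k i, s.Reached P f h R k i → ∀ N : ℕ,
    IsLeast {N' : ℕ | s.LineSearch P f h R k i (P.lsγ ^ N')} N → s.α k i = P.lsγ ^ N
  /-- Acceptance: the pass with `ρ_k ≥ η₁` yields the next iterate. -/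
  accept_X : ∀ k i, s.Reached P f h R k i → P.η₁ ≤ s.ratio P f h R k i →
    s.X (k + 1) = s.trial R k i (s.α k i)
  /-- On acceptance the parameter is passed on, multiplied by `γ₁` first if `ρ_k ≥ η₂`. -/
  accept_σ : ∀ k i, s.Reached P f h R k i → P.η₁ ≤ s.ratio P f h R k i →
    s.σ (k + 1) =
      if P.η₂ ≤ s.ratio P f h R k i then P.γ₁ * s.reg P k i else s.reg P k i

end ARPQN

end

/-! Both inner loops terminate, with stepsizes bounded below and regularization parameters bounded
above. Each accepted step lies below the maximum of F over the current window by a multiple of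
‖V_k‖², while F changes by at most a multiple of ‖V_k‖. The window argument
`exists_tendsto_of_window_decrease` then makes F(X_k) converge and V_k vanish, and minimality of V_k
passes to the limit: ⟨∇f(X*), ζ⟩ + h(X* + ζ) − h(X*) ≥ 0 for tangent ζ.

The geometry is in `IsRetraction.exists_local_bounds`. A manifold point X near X* is R_{X*}(ζ), and
W = −DR_{X*}(ζ)[ζ] is tangent at X with X + W = X* up to (M₂ + o(1))‖ζ‖². The Hessian contributes
−(δ/2)‖ζ‖² and the error in h costs L_h M₂‖ζ‖², so δ > 2 L_h M₂ leaves a strict gain. With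
stationarity this gives quadratic growth at X*, and vanishing steps then force the whole sequence to
converge (`tendsto_of_quadratic_growth`). It also gives a direction W whose first-order decrease
exceeds F(X) − F(X*).

Testing φ_k on a small multiple of W bounds F(X_k) − F(X*) by a multiple of the predicted decrease
d. The next gap is at most C d, and at most the window gap minus η₁ a₀ d. Eliminating d gives a
contraction relative to the window (`objective_contraction`), whose (m+1)-th root is the linear rate
(`exists_rate_of_window_contraction`). -/

noncomputable section

namespace ARPQN

/-! ### Second-order Taylor expansions. -/

section Calculus

variable {E F : Type*} [NormedAddCommGroup E] [NormedSpace ℝ E]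
  [NormedAddCommGroup F] [NormedSpace ℝ F]

theorem eventually_norm_fderiv_sub_le {G : E → F} (hG : ContDiff ℝ 2 G) {ε : ℝ} (hε : 0 < ε) :
    ∀ᶠ ζ in 𝓝 (0 : E),
      ‖fderiv ℝ G ζ - fderiv ℝ G 0 - fderiv ℝ (fderiv ℝ G) 0 ζ‖ ≤ ε * ‖ζ‖ := by
  have hD : HasFDerivAt (fderiv ℝ G) (fderiv ℝ (fderiv ℝ G) 0) 0 :=
    ((hG.fderiv_right (m := 1) (by norm_num)).differentiable (by norm_num) 0).hasFDerivAt
  simpa using hD.isLittleO.def hε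

/-- First-order expansion of the derivative, evaluated along the displacement. -/
theorem eventually_norm_fderiv_apply_sub_le {G : E → F} (hG : ContDiff ℝ 2 G) {ε : ℝ}
    (hε : 0 < ε) :
    ∀ᶠ ζ in 𝓝 (0 : E),
      ‖fderiv ℝ G ζ ζ - fderiv ℝ G 0 ζ - fderiv ℝ (fderiv ℝ G) 0 ζ ζ‖ ≤ ε * ‖ζ‖ ^ 2 := by
  filter_upwards [eventually_norm_fderiv_sub_le hG hε] with ζ hζ
  calc _ = ‖(fderiv ℝ G ζ - fderiv ℝ G 0 - fderiv ℝ (fderiv ℝ G) 0 ζ) ζ‖ := by simp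
    _ ≤ (ε * ‖ζ‖) * ‖ζ‖ := ContinuousLinearMap.le_of_opNorm_le _ hζ ζ
    _ = _ := by ring

/-- Second-order Taylor expansion of a vector-valued map at the origin. -/
theorem eventually_norm_taylor_two_le {G : E → F} (hG : ContDiff ℝ 2 G) {ε : ℝ} (hε : 0 < ε) :
    ∀ᶠ ζ in 𝓝 (0 : E),
      ‖G ζ - G 0 - fderiv ℝ G 0 ζ - (1 / 2 : ℝ) • fderiv ℝ (fderiv ℝ G) 0 ζ ζ‖
        ≤ ε * ‖ζ‖ ^ 2 := by
  obtain ⟨ρ, hρ, hb⟩ := Metric.eventually_nhds_iff_ball.1 (eventually_norm_fderiv_sub_le hG hε)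
  filter_upwards [Metric.ball_mem_nhds 0 hρ] with ζ hζ
  set A := fderiv ℝ G 0 ζ
  set Q := fderiv ℝ (fderiv ℝ G) 0 ζ ζ
  -- The mean value inequality on [0, 1] for this curve reduces the claim to the expansion of DG at
  -- tζ.
  have hder : ∀ t : ℝ, HasDerivAt (fun t : ℝ => G (t • ζ) - t • A - (t ^ 2 / 2) • Q)
      (fderiv ℝ G (t • ζ) ζ - A - t • Q) t := by
    intro t
    have h1 : HasDerivAt (fun t : ℝ => G (t • ζ)) (fderiv ℝ G (t • ζ) ζ) t := by
      have := (hG.differentiable (by norm_num) (t • ζ)).hasFDerivAt.comp_hasDerivAt t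
        ((hasDerivAt_id t).smul_const ζ)
      simpa [Function.comp_def] using this
    have h2 : HasDerivAt (fun t : ℝ => t • A) A t := by
      simpa using (hasDerivAt_id t).smul_const A
    have h3 : HasDerivAt (fun t : ℝ => (t ^ 2 / 2) • Q) (t • Q) t := by
      have := (((hasDerivAt_id t).pow 2).div_const 2).smul_const Q
      simpa using this
    exact (h1.sub h2).sub h3
  have hbound : ∀ t ∈ Set.Ico (0 : ℝ) 1,
      ‖fderiv ℝ G (t • ζ) ζ - A - t • Q‖ ≤ ε * ‖ζ‖ ^ 2 := by
    intro t ht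
    have htn : ‖t • ζ‖ ≤ ‖ζ‖ := by
      rw [norm_smul, Real.norm_of_nonneg ht.1]
      exact mul_le_of_le_one_left (norm_nonneg _) ht.2.le
    have := hb (t • ζ) (by
      rw [mem_ball_zero_iff] at hζ ⊢
      exact htn.trans_lt hζ)
    calc _ = ‖(fderiv ℝ G (t • ζ) - fderiv ℝ G 0 - fderiv ℝ (fderiv ℝ G) 0 (t • ζ)) ζ‖ := by
          simp [A, Q]
      _ ≤ (ε * ‖t • ζ‖) * ‖ζ‖ := ContinuousLinearMap.le_of_opNorm_le _ this ζ
      _ ≤ (ε * ‖ζ‖) * ‖ζ‖ := by gcongr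
      _ = _ := by ring
  have := norm_image_sub_le_of_norm_deriv_le_segment_01'
    (fun t _ => (hder t).hasDerivWithinAt) hbound
  simp only [one_smul, zero_smul, one_pow] at this
  convert this using 2
  simp
  abel

/-- A bound `‖G ζ - G 0 - DG(0) ζ‖ ≤ M ‖ζ‖²` passes to the second derivative. -/
theorem norm_half_snd_fderiv_le {G : E → F} (hG : ContDiff ℝ 2 G) {M : ℝ}
    (hM : ∀ ζ, ‖G ζ - G 0 - fderiv ℝ G 0 ζ‖ ≤ M * ‖ζ‖ ^ 2) (ζ : E) :
    ‖(1 / 2 : ℝ) • fderiv ℝ (fderiv ℝ G) 0 ζ ζ‖ ≤ M * ‖ζ‖ ^ 2 := by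
  refine le_of_forall_pos_le_add fun ε hε => ?_
  obtain ⟨η, hη, hηε⟩ : ∃ η : ℝ, 0 < η ∧ η * ‖ζ‖ ^ 2 ≤ ε := by
    refine ⟨ε / (‖ζ‖ ^ 2 + 1), by positivity, ?_⟩
    rw [div_mul_eq_mul_div, div_le_iff₀ (by positivity)]
    nlinarith
  -- At tζ, for one small t > 0, every term scales like t²; dividing by t² leaves only the error
  -- η‖ζ‖² ≤ ε.
  have hev := eventually_norm_taylor_two_le hG hη
  have ht : Filter.Tendsto (fun t : ℝ => t • ζ) (𝓝[>] 0) (𝓝 0) := by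
    have : Continuous fun t : ℝ => t • ζ := by fun_prop
    simpa using (this.tendsto 0).mono_left nhdsWithin_le_nhds
  obtain ⟨t, ht1, ht0⟩ := ((ht.eventually hev).and self_mem_nhdsWithin).exists
  have ht0 : 0 < t := ht0
  have hm := hM (t • ζ)
  set Q := fderiv ℝ (fderiv ℝ G) 0 ζ ζ
  have hQ : fderiv ℝ (fderiv ℝ G) 0 (t • ζ) (t • ζ) = t ^ 2 • Q := by
    simp [Q, smul_smul, pow_two]
  rw [hQ] at ht1
  have h3 : ‖(1 / 2 : ℝ) • t ^ 2 • Q‖ ≤ M * ‖t • ζ‖ ^ 2 + η * ‖t • ζ‖ ^ 2 := by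
    refine le_trans ?_ (add_le_add hm ht1)
    refine le_trans (le_of_eq ?_) (norm_sub_le _ _)
    congr 1
    abel
  rw [smul_comm, norm_smul (t ^ 2), norm_smul t, Real.norm_of_nonneg (sq_nonneg t),
    Real.norm_of_nonneg ht0.le] at h3
  have h4 : t ^ 2 * ‖(1 / 2 : ℝ) • Q‖ ≤ t ^ 2 * (M * ‖ζ‖ ^ 2 + η * ‖ζ‖ ^ 2) := by
    calc _ ≤ _ := h3
      _ = _ := by ring
  have h5 := le_of_mul_le_mul_left h4 (by positivity)
  linarith

end Calculus

/-! ### From eigenvalues of the Hessian to its quadratic form. -/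

section Hessian

variable {E : Type*} [NormedAddCommGroup E] [InnerProductSpace ℝ E] [FiniteDimensional ℝ E]

theorem inner_hessian {g : E → ℝ} (hg : ContDiff ℝ 2 g) (x v w : E) :
    inner ℝ (hessian g x v) w = fderiv ℝ (fderiv ℝ g) x v w := by
  have hD : HasFDerivAt (fderiv ℝ g) (fderiv ℝ (fderiv ℝ g) x) x :=
    ((hg.fderiv_right (m := 1) (by norm_num)).differentiable (by norm_num) x).hasFDerivAt
  -- The inverse Riesz map is typed as conjugate-linear; over ℝ it is repackaged as a linear map for
  -- the chain rule.
  let T : StrongDual ℝ E →L[ℝ] E :=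
    LinearMap.toContinuousLinearMap
      { toFun := fun l => (InnerProductSpace.toDual ℝ E).symm l
        map_add' := fun a b => map_add _ a b
        map_smul' := fun c a => by simp }
  have hT : HasFDerivAt (gradient g) (T ∘L fderiv ℝ (fderiv ℝ g) x) x :=
    T.hasFDerivAt.comp x hD
  rw [hessian, hT.fderiv]
  simp [T]

/-- In finite dimension the infimum of the Rayleigh quotient of a symmetric operator is an
eigenvalue, hence at least δ. -/
theorem LambdaMinGE.le_inner {A : E →L[ℝ] E} {δ : ℝ} (h : LambdaMinGE A δ)
    (hA : (A : E →ₗ[ℝ] E).IsSymmetric) (v : E) : δ * ‖v‖ ^ 2 ≤ inner ℝ (A v) v := by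
  rcases eq_or_ne v 0 with rfl | hv
  · simp
  have : Nontrivial E := ⟨v, 0, hv⟩
  have h1 := h _ hA.hasEigenvalue_iInf_of_finiteDimensional
  have h2 : δ ≤ inner ℝ (A v) v / ‖v‖ ^ 2 := by
    refine h1.trans (ciInf_le (f := fun x : { x : E // x ≠ 0 } =>
      (RCLike.re (inner ℝ ((A : E →ₗ[ℝ] E) x) (x : E)) / ‖(x : E)‖ ^ 2 : ℝ)) ?_ ⟨v, hv⟩)
    refine ⟨-‖A‖, ?_⟩
    rintro _ ⟨⟨x, hx⟩, rfl⟩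
    have hx' : 0 < ‖x‖ ^ 2 := by positivity
    rw [le_div_iff₀ hx']
    have h3 := abs_real_inner_le_norm (A x) x
    have h4 := A.le_opNorm x
    have h5 := neg_le_of_abs_le h3
    simp only [RCLike.re_to_real, ContinuousLinearMap.coe_coe]
    nlinarith [norm_nonneg x]
  exact (le_div_iff₀ (by positivity)).1 h2

theorem le_snd_fderiv_of_lambdaMinGE {g : E → ℝ} (hg : ContDiff ℝ 2 g) {x : E} {δ : ℝ}
    (h : LambdaMinGE (hessian g x) δ) (v : E) :
    δ * ‖v‖ ^ 2 ≤ fderiv ℝ (fderiv ℝ g) x v v := by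
  rw [← inner_hessian hg]
  refine h.le_inner (fun a b => ?_) v
  rw [ContinuousLinearMap.coe_coe, real_inner_comm (hessian g x b) a, inner_hessian hg, inner_hessian hg]
  exact (hg.contDiffAt.isSymmSndFDerivAt (by simp)).eq a b

end Hessian

/-! ### Matrix products and the tangent projection. -/

section Matrices

variable {n r p : ℕ}

/-- The element of `MatSpace n r` with the entries of the matrix `M`. -/
def ofMat (M : Matrix (Fin n) (Fin r) ℝ) : MatSpace n r := WithLp.toLp 2 fun q => M q.1 q.2

@[simp] theorem ofMat_toMat (X : MatSpace n r) : ofMat (toMat X) = X := rfl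

theorem toMat_injective : Function.Injective (toMat : MatSpace n r → _) :=
  Function.LeftInverse.injective ofMat_toMat

theorem toMat_sub (X Y : MatSpace n r) : toMat (X - Y) = toMat X - toMat Y := rfl

theorem ofMat_add (M N : Matrix (Fin n) (Fin r) ℝ) : ofMat (M + N) = ofMat M + ofMat N := rfl

theorem ofMat_smul (c : ℝ) (M : Matrix (Fin n) (Fin r) ℝ) : ofMat (c • M) = c • ofMat M := rfl

theorem continuous_toMat : Continuous (toMat : MatSpace n r → _) := by
  refine continuous_matrix fun i j => ?_
  simp only [toMat, Matrix.of_apply]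
  fun_prop

theorem continuous_ofMat : Continuous (ofMat : _ → MatSpace n r) := by
  refine (PiLp.continuous_toLp 2 _).comp (continuous_pi fun q => ?_)
  exact Continuous.matrix_elem continuous_id _ _

/-- Matrix multiplication as a continuous bilinear map. -/
def mulL : MatSpace n r →L[ℝ] MatSpace r p →L[ℝ] MatSpace n p :=
  (LinearMap.mk₂ ℝ (fun X S => ofMat (toMat X * toMat S))
    (fun X Y S => by simp only [toMat_add, Matrix.add_mul, ofMat_add])
    (fun c X S => by simp only [toMat_smul, Matrix.smul_mul, ofMat_smul])
    (fun X S T => by simp only [toMat_add, Matrix.mul_add, ofMat_add])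
    (fun c X S => by simp only [toMat_smul, Matrix.mul_smul, ofMat_smul])).toContinuousBilinearMap

@[simp] theorem toMat_mulL (X : MatSpace n r) (S : MatSpace r p) :
    toMat (mulL X S) = toMat X * toMat S := rfl

/-- The symmetric part `(XᵀZ + ZᵀX) / 2` of `XᵀZ`. -/
def symPart (X : MatSpace n r) : MatSpace n r →L[ℝ] MatSpace r r :=
  LinearMap.toContinuousLinearMap
    { toFun := fun Z => ofMat ((1 / 2 : ℝ) • ((toMat X).transpose * toMat Z
        + (toMat Z).transpose * toMat X))
      map_add' := fun Z W => by
        rw [← ofMat_add, ← smul_add, toMat_add, Matrix.transpose_add, Matrix.mul_add,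
          Matrix.add_mul, add_add_add_comm]
      map_smul' := fun c Z => by
        simp only [toMat_smul, Matrix.transpose_smul, Matrix.mul_smul, Matrix.smul_mul,
          RingHom.id_apply]
        rw [← smul_add, smul_comm, ofMat_smul] }

theorem toMat_symPart (X Z : MatSpace n r) :
    toMat (symPart X Z) = (1 / 2 : ℝ) • ((toMat X).transpose * toMat Z
        + (toMat Z).transpose * toMat X) := rfl

theorem transpose_toMat_symPart (X Z : MatSpace n r) :
    (toMat (symPart X Z)).transpose = toMat (symPart X Z) := by
  rw [toMat_symPart, Matrix.transpose_smul, Matrix.transpose_add, Matrix.transpose_mul,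
    Matrix.transpose_mul, Matrix.transpose_transpose, Matrix.transpose_transpose, add_comm]

theorem symPart_eq_zero {X ξ : MatSpace n r} (hξ : ξ ∈ tangentSpace X) : symPart X ξ = 0 := by
  apply toMat_injective
  have h : (toMat ξ).transpose * toMat X + (toMat X).transpose * toMat ξ = 0 := hξ
  rw [toMat_symPart, add_comm, h, smul_zero, toMat_zero]

/-- The orthogonal projection `Z - X (XᵀZ + ZᵀX) / 2` onto the tangent space at a point `X` of the
Stiefel manifold. -/
def tangentProj (X : MatSpace n r) : MatSpace n r →L[ℝ] MatSpace n r :=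
  ContinuousLinearMap.id ℝ _ - (mulL X).comp (symPart X)

theorem tangentProj_apply (X Z : MatSpace n r) :
    tangentProj X Z = Z - mulL X (symPart X Z) := rfl

theorem tangentProj_mem {X : MatSpace n r} (hX : X ∈ stiefel n r) (Z : MatSpace n r) :
    tangentProj X Z ∈ tangentSpace X := by
  have hX : (toMat X).transpose * toMat X = 1 := hX
  change (toMat (tangentProj X Z)).transpose * toMat X
    + (toMat X).transpose * toMat (tangentProj X Z) = 0
  rw [tangentProj_apply, toMat_sub, toMat_mulL, Matrix.transpose_sub, Matrix.transpose_mul,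
    transpose_toMat_symPart, Matrix.sub_mul, Matrix.mul_sub, Matrix.mul_assoc, hX,
    ← Matrix.mul_assoc, hX, Matrix.mul_one, Matrix.one_mul, toMat_symPart]
  module

theorem tangentProj_eq_self {X ξ : MatSpace n r} (hξ : ξ ∈ tangentSpace X) :
    tangentProj X ξ = ξ := by
  rw [tangentProj_apply, symPart_eq_zero hξ, map_zero, sub_zero]

/-- Used to transport a tangent vector at the limit point to tangent vectors at the iterates. -/
theorem continuous_tangentProj (Z : MatSpace n r) :
    Continuous fun X : MatSpace n r => tangentProj X Z := by
  have h : ∀ X : MatSpace n r, tangentProj X Z = Z - ofMat (toMat X *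
      ((1 / 2 : ℝ) • ((toMat X).transpose * toMat Z + (toMat Z).transpose * toMat X))) :=
    fun X => rfl
  simp only [h]
  refine continuous_const.sub (continuous_ofMat.comp ?_)
  have hc := continuous_toMat (n := n) (r := r)
  have h1 : Continuous fun X : MatSpace n r => (toMat X).transpose * toMat Z :=
    hc.matrix_transpose.matrix_mul continuous_const
  have h2 : Continuous fun X : MatSpace n r => (toMat Z).transpose * toMat X :=
    continuous_const.matrix_mul hc
  exact hc.matrix_mul ((h1.add h2).const_smul (1 / 2 : ℝ))

end Matrices

/-! ### Compactness and tangent vectors of the Stiefel manifold. -/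

section Stiefel

variable {n r : ℕ}

theorem norm_sq_of_mem_stiefel {X : MatSpace n r} (hX : X ∈ stiefel n r) : ‖X‖ ^ 2 = r := by
  have hX : (toMat X).transpose * toMat X = 1 := hX
  rw [← real_inner_self_eq_norm_sq, inner_eq_trace, hX]
  simp

theorem norm_of_mem_stiefel {X : MatSpace n r} (hX : X ∈ stiefel n r) : ‖X‖ = √r := by
  rw [← norm_sq_of_mem_stiefel hX, Real.sqrt_sq (norm_nonneg _)]

theorem isClosed_stiefel : IsClosed (stiefel n r) := by
  have hc := continuous_toMat (n := n) (r := r)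
  exact isClosed_eq (hc.matrix_transpose.matrix_mul hc) continuous_const

theorem isCompact_stiefel : IsCompact (stiefel n r) := by
  refine Metric.isCompact_of_isClosed_isBounded isClosed_stiefel ?_
  refine (Metric.isBounded_closedBall (x := 0) (r := √r)).subset fun X hX => ?_
  simp [norm_of_mem_stiefel hX]

/-- The velocity of a curve in the Stiefel manifold is tangent. -/
theorem mem_tangentSpace_of_hasDerivAt {c : ℝ → MatSpace n r} {c' : MatSpace n r} {t : ℝ}
    (hc : ∀ u, c u ∈ stiefel n r) (h : HasDerivAt c c' t) : c' ∈ tangentSpace (c t) := by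
  have hco : ∀ i j, HasDerivAt (fun u => c u (i, j)) (c' (i, j)) t := fun i j => by
    have := (EuclideanSpace.proj (i, j) : MatSpace n r →L[ℝ] ℝ).hasFDerivAt.comp_hasDerivAt t h
    exact this
  change (toMat c').transpose * toMat (c t) + (toMat (c t)).transpose * toMat c' = 0
  ext a b
  have h1 : HasDerivAt (fun u => ∑ i, c u (i, a) * c u (i, b))
      (∑ i, (c' (i, a) * c t (i, b) + c t (i, a) * c' (i, b))) t :=
    HasDerivAt.fun_sum fun i _ => (hco i a).mul (hco i b)
  have h2 : (fun u => ∑ i, c u (i, a) * c u (i, b)) = fun _ => (1 : Matrix _ _ ℝ) a b := by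
    funext u
    have : (toMat (c u)).transpose * toMat (c u) = 1 := hc u
    rw [← this]
    simp [Matrix.mul_apply, toMat]
  rw [h2] at h1
  have h3 := h1.unique (hasDerivAt_const t _)
  rw [Finset.sum_add_distrib] at h3
  simpa [Matrix.mul_apply, toMat] using h3

/-- The only small symmetric `S` with `(1 + S)² = 1` is `0`. -/
theorem eventually_eq_zero_of_sq_eq_one (r : ℕ) :
    ∀ᶠ S in 𝓝 (0 : MatSpace r r), (1 + toMat S) * (1 + toMat S) = 1 → S = 0 := by
  set C := ‖(mulL : MatSpace r r →L[ℝ] MatSpace r r →L[ℝ] MatSpace r r)‖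
  have hC : 0 ≤ C := by positivity
  -- The equation says 2S = −S², so S ≠ 0 forces 2 ≤ C‖S‖. The `+ 1` covers C = 0.
  filter_upwards [Metric.ball_mem_nhds (0 : MatSpace r r) (show 0 < 2 / (C + 1) by positivity)]
    with S hS h
  have h2 : (2 : ℝ) • S = - mulL S S := by
    apply toMat_injective
    have : toMat (-mulL S S) = -(toMat S * toMat S) := rfl
    rw [toMat_smul, this]
    simp only [Matrix.add_mul, Matrix.mul_add, Matrix.one_mul, Matrix.mul_one] at h
    rw [eq_neg_iff_add_eq_zero, two_smul]
    have h' := sub_eq_zero.2 h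
    rw [← h']
    abel
  by_contra h0
  have hpos : 0 < ‖S‖ := norm_pos_iff.2 h0
  have h3 : 2 * ‖S‖ ≤ C * ‖S‖ * ‖S‖ := by
    calc 2 * ‖S‖ = ‖(2 : ℝ) • S‖ := by rw [norm_smul]; norm_num
      _ = ‖mulL S S‖ := by rw [h2, norm_neg]
      _ ≤ _ := ContinuousLinearMap.le_opNorm₂ _ _ _
  have h4 : 2 ≤ C * ‖S‖ := le_of_mul_le_mul_right h3 hpos
  rw [mem_ball_zero_iff, lt_div_iff₀ (by positivity)] at hS
  nlinarith

end Stiefel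

/-! ### Local surjectivity of the retraction. -/

section Retraction

variable {n r : ℕ} {R : MatSpace n r → MatSpace n r → MatSpace n r}

theorem IsRetraction.contDiff (hR : IsRetraction R) {X : MatSpace n r} (hX : X ∈ stiefel n r) :
    ContDiff ℝ ∞ fun ξ : tangentSpace X => R X (ξ : MatSpace n r) := by
  have h : ContDiff ℝ ∞ fun ξ : tangentSpace X => (X, (ξ : MatSpace n r)) :=
    contDiff_const.prodMk (tangentSpace X).subtypeL.contDiff
  rw [← contDiffOn_univ]
  exact hR.smooth.comp h.contDiffOn fun ξ _ => ⟨hX, ξ.2⟩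

theorem IsRetraction.contDiff_two (hR : IsRetraction R) {X : MatSpace n r}
    (hX : X ∈ stiefel n r) : ContDiff ℝ 2 fun ξ : tangentSpace X => R X (ξ : MatSpace n r) :=
  (hR.contDiff hX).of_le ENat.LEInfty.out

theorem IsRetraction.fderiv_zero (hR : IsRetraction R) {X : MatSpace n r}
    (hX : X ∈ stiefel n r) :
    fderiv ℝ (fun ξ : tangentSpace X => R X (ξ : MatSpace n r)) 0 = (tangentSpace X).subtypeL :=
  (hR.deriv_zero X hX).fderiv

/-- This is the velocity of the curve t ↦ R_X(ζ + tη). It makes −DR_X(ζ)[ζ] an admissible test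
vector for the model at R_X(ζ). -/
theorem IsRetraction.fderiv_mem (hR : IsRetraction R) {X : MatSpace n r}
    (hX : X ∈ stiefel n r) (ζ η : tangentSpace X) :
    fderiv ℝ (fun ξ : tangentSpace X => R X (ξ : MatSpace n r)) ζ η ∈
      tangentSpace (R X (ζ : MatSpace n r)) := by
  have h1 : HasDerivAt (fun t : ℝ => ζ + t • η) η 0 := by
    simpa using ((hasDerivAt_id (0 : ℝ)).smul_const η).const_add ζ
  have h2 := HasFDerivAt.comp_hasDerivAt_of_eq (0 : ℝ)
    ((hR.contDiff hX).differentiable (by simp) ζ).hasFDerivAt h1 (by simp)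
  have h3 := mem_tangentSpace_of_hasDerivAt (fun u => hR.mapsTo X hX _ (ζ + u • η).2) h2
  simpa using h3

/-- The points of the Stiefel manifold near `X` are values of the retraction at `X` on small
tangent vectors. -/
theorem IsRetraction.eventually_exists_preimage (hR : IsRetraction R) {X : MatSpace n r}
    (hX : X ∈ stiefel n r) {p : tangentSpace X → Prop} (hp : ∀ᶠ ζ in 𝓝 0, p ζ) :
    ∀ᶠ Y in 𝓝 X, Y ∈ stiefel n r → ∃ ζ : tangentSpace X, R X (ζ : MatSpace n r) = Y ∧ p ζ := by
  let π : MatSpace n r →L[ℝ] tangentSpace X :=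
    (tangentProj X).codRestrict (tangentSpace X) (tangentProj_mem hX)
  let G : tangentSpace X → MatSpace n r := fun ξ => R X (ξ : MatSpace n r)
  -- Ψ(Z) = G(πZ)(I + S), with S the symmetric part of XᵀZ, extends the retraction to the ambient
  -- space. Its derivative at 0 is Z ↦ πZ + XS = Z, so it is locally onto. If Ψ(Z) lies on the
  -- manifold then (I + S)² = I, hence S = 0 and Ψ(Z) = G(πZ).
  let Ψ : MatSpace n r → MatSpace n r := fun Z => G (π Z) + mulL (G (π Z)) (symPart X Z)
  have hG0 : G (π 0) = X := by simp [G, hR.map_zero X hX]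
  have hG0' : G 0 = X := by simp [G, hR.map_zero X hX]
  have hGd : HasStrictFDerivAt G (tangentSpace X).subtypeL (π 0) := by
    rw [_root_.map_zero, ← hR.fderiv_zero hX]
    exact (hR.contDiff hX).contDiffAt.hasStrictFDerivAt (by simp)
  have hu : HasStrictFDerivAt (fun Z => G (π Z)) ((tangentSpace X).subtypeL ∘L π) 0 :=
    hGd.comp (0 : MatSpace n r) π.hasStrictFDerivAt
  have hΨ : HasStrictFDerivAt Ψ (ContinuousLinearEquiv.refl ℝ (MatSpace n r) :
      MatSpace n r →L[ℝ] MatSpace n r) 0 := by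
    have h : HasStrictFDerivAt Ψ _ 0 :=
      hu.add (mulL.hasStrictFDerivAt_of_bilinear hu (symPart X).hasStrictFDerivAt)
    refine h.congr_fderiv ?_
    ext1 Z
    simp [hG0', π, tangentProj_apply]
  have hΨ0 : Ψ 0 = X := by simp [Ψ, hG0']
  have hmap := hΨ.map_nhds_eq_of_equiv
  rw [hΨ0] at hmap
  rw [← hmap, Filter.eventually_map]
  have hsurj : ∀ᶠ Z in 𝓝 (0 : MatSpace n r), p (π Z) ∧ ((1 + toMat (symPart X Z)) *
      (1 + toMat (symPart X Z)) = 1 → symPart X Z = 0) := by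
    have h1 : Filter.Tendsto π (𝓝 0) (𝓝 0) := by simpa using π.continuous.tendsto 0
    have h2 : Filter.Tendsto (symPart X) (𝓝 0) (𝓝 0) := by
      simpa using (symPart X).continuous.tendsto 0
    exact (h1.eventually hp).and (h2.eventually (eventually_eq_zero_of_sq_eq_one r))
  filter_upwards [hsurj] with Z hZ hmem
  refine ⟨π Z, ?_, hZ.1⟩
  have hS : symPart X Z = 0 := by
    apply hZ.2
    have hGm : (toMat (G (π Z))).transpose * toMat (G (π Z)) = 1 :=
      hR.mapsTo X hX _ (π Z).2
    have hm : (toMat (Ψ Z)).transpose * toMat (Ψ Z) = 1 := hmem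
    have hΨm : toMat (Ψ Z) = toMat (G (π Z)) * (1 + toMat (symPart X Z)) := by
      rw [Matrix.mul_add, Matrix.mul_one]; rfl
    rw [hΨm, Matrix.transpose_mul, Matrix.transpose_add, Matrix.transpose_one,
      transpose_toMat_symPart, Matrix.mul_assoc, ← Matrix.mul_assoc (toMat (G (π Z))).transpose,
      hGm, Matrix.one_mul] at hm
    exact hm
  simp [Ψ, hS, G]

end Retraction

/-! ### Second-order inequalities near the accumulation point. -/

section Local

variable {n r : ℕ} {R : MatSpace n r → MatSpace n r → MatSpace n r}

theorem _root_.LipschitzWith.le_add_of_norm_sub_le {E : Type*} [SeminormedAddCommGroup E]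
    {h : E → ℝ} {L : ℝ≥0} (hh : LipschitzWith L h) {x y : E} {b : ℝ} (hb : ‖x - y‖ ≤ b) :
    h x ≤ h y + L * b := by
  have h1 := (le_abs_self _).trans ((Real.norm_eq_abs _).symm.le.trans (hh.norm_sub_le x y))
  have h2 : (L : ℝ) * ‖x - y‖ ≤ L * b := by gcongr
  linarith

/-- Second-order model inequalities at the points `X` of the Stiefel manifold near `X₀`, in terms
of the preimage `ζ` of `X` under the retraction at `X₀` and a tangent vector `W` at `X` pointing
to `X₀`. -/
theorem IsRetraction.exists_local_bounds (hR : IsRetraction R) {M₂ : ℝ}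
    (hM₂ : ∀ X ∈ stiefel n r, ∀ ξ ∈ tangentSpace X, ‖R X ξ - X - ξ‖ ≤ M₂ * ‖ξ‖ ^ 2)
    {f h : MatSpace n r → ℝ} (hf : ContDiff ℝ 2 f) {Lh : ℝ≥0} (hh : LipschitzWith Lh h)
    {X₀ : MatSpace n r} (hX₀ : X₀ ∈ stiefel n r) {δ : ℝ} (hδ : 2 * (Lh : ℝ) * M₂ < δ)
    (hHess : LambdaMinGE (hessian (fun ξ : tangentSpace X₀ => f (R X₀ (ξ : MatSpace n r))) 0) δ) :
    ∃ c : ℝ, 0 < c ∧ ∀ᶠ X in 𝓝 X₀, X ∈ stiefel n r →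
      ∃ ζ : tangentSpace X₀, ∃ W : tangentSpace X, ‖W‖ ≤ 2 * ‖ζ‖ ∧ ‖X - X₀‖ ≤ 2 * ‖ζ‖ ∧
        inner ℝ (gradient f X) (W : MatSpace n r) + h (X + W) - h X
          ≤ (f + h) X₀ - (f + h) X - c * ‖ζ‖ ^ 2 ∧
        (f + h) X₀ + (inner ℝ (gradient f X₀) (ζ : MatSpace n r) + h (X₀ + ζ) - h X₀)
          + c * ‖ζ‖ ^ 2 ≤ (f + h) X := by
  set G : tangentSpace X₀ → MatSpace n r := fun ξ => R X₀ (ξ : MatSpace n r) with hGdef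
  have hG2 : ContDiff ℝ 2 G := hR.contDiff_two hX₀
  have hG0 : G 0 = X₀ := hR.map_zero X₀ hX₀
  have hDG0 : fderiv ℝ G 0 = (tangentSpace X₀).subtypeL := hR.fderiv_zero hX₀
  have hg2 : ContDiff ℝ 2 (fun ξ => f (G ξ)) := hf.comp hG2
  have hDg : ∀ ζ η, fderiv ℝ (fun ξ => f (G ξ)) ζ η
      = inner ℝ (gradient f (G ζ)) (fderiv ℝ G ζ η) := fun ζ η => by
    rw [inner_gradient_left]
    have := (hf.differentiable (by norm_num) (G ζ)).hasFDerivAt.comp ζ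
      (hG2.differentiable (by norm_num) ζ).hasFDerivAt
    rw [show (fun ξ => f (G ξ)) = f ∘ G from rfl, this.fderiv]
    rfl
  have hGM : ∀ ζ, ‖G ζ - G 0 - fderiv ℝ G 0 ζ‖ ≤ M₂ * ‖ζ‖ ^ 2 := fun ζ => by
    rw [hG0, hDG0]; exact hM₂ X₀ hX₀ ζ ζ.2
  -- The exact second-order gain is b = δ/2 − L_h M₂; ε is chosen so that all Taylor errors together
  -- cost at most b/2.
  set b := (δ - 2 * Lh * M₂) / 2 with hb
  have hb0 : 0 < b := by rw [hb]; linarith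
  have hLh : (0 : ℝ) ≤ Lh := Lh.2
  set ε := b / (4 * (1 + Lh)) with hε
  have hε0 : 0 < ε := by positivity
  have hεb : ε * (4 * (1 + Lh)) = b := by rw [hε]; field_simp
  refine ⟨b / 2, by positivity, ?_⟩
  have hDGnear : ∀ᶠ ζ in 𝓝 (0 : tangentSpace X₀), ‖fderiv ℝ G ζ‖ ≤ 2 := by
    have hc : Continuous fun ζ => ‖fderiv ℝ G ζ‖ :=
      (continuous_norm (E := tangentSpace X₀ →L[ℝ] MatSpace n r)).comp
        (hG2.continuous_fderiv (by norm_num))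
    refine (hc.tendsto 0).eventually_le_const ?_
    rw [hDG0]
    exact (Submodule.norm_subtypeL_le _).trans_lt (by norm_num)
  have hsmall : ∀ᶠ ζ in 𝓝 (0 : tangentSpace X₀), M₂ * ‖ζ‖ ≤ 1 := by
    have hc : Continuous fun ζ : tangentSpace X₀ => M₂ * ‖ζ‖ := by fun_prop
    exact (hc.tendsto 0).eventually_le_const (by simp)
  filter_upwards [hR.eventually_exists_preimage hX₀ (hDGnear.and (hsmall.and
    ((eventually_norm_taylor_two_le hG2 hε0).and ((eventually_norm_fderiv_apply_sub_le hG2 hε0).and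
    ((eventually_norm_taylor_two_le hg2 hε0).and
      (eventually_norm_fderiv_apply_sub_le hg2 hε0))))))] with X hX hXm
  obtain ⟨ζ, hζX, h1, h2, hG₁, hG₂, hg₁, hg₂⟩ := hX hXm
  have hGζ : G ζ = X := hζX
  have hWm : -(fderiv ℝ G ζ ζ) ∈ tangentSpace X := by
    rw [← hGζ]; exact neg_mem (hR.fderiv_mem hX₀ ζ ζ)
  refine ⟨ζ, ⟨-(fderiv ℝ G ζ ζ), hWm⟩, ?_, ?_, ?_, ?_⟩
  · rw [Submodule.coe_norm, norm_neg]
    exact ContinuousLinearMap.le_of_opNorm_le _ h1 ζ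
  · have h3 := hM₂ X₀ hX₀ ζ ζ.2
    rw [hζX] at h3
    have h4 : ‖X - X₀‖ ≤ ‖X - X₀ - ζ‖ + ‖(ζ : MatSpace n r)‖ := by
      simpa using norm_add_le (X - X₀ - ζ) (ζ : MatSpace n r)
    have h5 := norm_nonneg ζ
    rw [← Submodule.coe_norm] at h4 h3
    nlinarith
  · have hQ := norm_half_snd_fderiv_le hG2 hGM ζ
    have hH := le_snd_fderiv_of_lambdaMinGE hg2 hHess ζ
    -- Subtracting the expansions of G(ζ) and DG(ζ)ζ cancels the first-order terms and leaves −½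
    -- D²G(0)[ζ, ζ], which M₂ controls.
    have hdist : ‖X + -(fderiv ℝ G ζ ζ) - X₀‖ ≤ (M₂ + 2 * ε) * ‖ζ‖ ^ 2 := by
      rw [hGζ, hG0] at hG₁
      set Q := fderiv ℝ (fderiv ℝ G) 0 ζ ζ
      have heq : X + -(fderiv ℝ G ζ ζ) - X₀ = (X - X₀ - fderiv ℝ G 0 ζ - (1 / 2 : ℝ) • Q)
          - (fderiv ℝ G ζ ζ - fderiv ℝ G 0 ζ - Q) - (1 / 2 : ℝ) • Q := by module
      rw [heq]
      have := (norm_sub_le _ _).trans (add_le_add_left (norm_sub_le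
        (X - X₀ - fderiv ℝ G 0 ζ - (1 / 2 : ℝ) • Q) (fderiv ℝ G ζ ζ - fderiv ℝ G 0 ζ - Q))
        ‖(1 / 2 : ℝ) • Q‖)
      linarith
    have hhX := hh.le_add_of_norm_sub_le hdist
    -- With g = f ∘ G, −Dg(ζ)ζ = g(0) − g(ζ) − ½ D²g(0)[ζ, ζ] up to 2ε‖ζ‖²; the Hessian bound
    -- supplies −(δ/2)‖ζ‖².
    have hgrad := hDg ζ ζ
    rw [Real.norm_eq_abs, abs_le] at hg₁ hg₂
    simp only [hGζ, hG0, smul_eq_mul] at hg₁ hg₂ hgrad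
    simp only [Pi.add_apply, inner_neg_right]
    rw [← hgrad]
    have hcoef : Lh * ((M₂ + 2 * ε) * ‖ζ‖ ^ 2) + 2 * (ε * ‖ζ‖ ^ 2) - 1 / 2 * (δ * ‖ζ‖ ^ 2)
        = - (b / 2 * ‖ζ‖ ^ 2) := by
      linear_combination (1 / 2 * ‖ζ‖ ^ 2) * hεb + ‖ζ‖ ^ 2 * hb
    linarith [hg₁.2, hg₂.1]
  · have hH := le_snd_fderiv_of_lambdaMinGE hg2 hHess ζ
    have h3 := hM₂ X₀ hX₀ ζ ζ.2
    rw [hζX, sub_sub, norm_sub_rev] at h3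
    -- For growth, h at X is compared with h at X₀ + ζ, again at cost L_h M₂‖ζ‖².
    have hhX := hh.le_add_of_norm_sub_le h3
    have hgrad := hDg 0 ζ
    rw [Real.norm_eq_abs, abs_le] at hg₁
    simp only [hGζ, hG0, hDG0, smul_eq_mul, Submodule.subtypeL_apply] at hg₁ hgrad
    simp only [Pi.add_apply]
    rw [← hgrad]
    rw [← Submodule.coe_norm] at hhX
    have hcoef : Lh * (M₂ * ‖ζ‖ ^ 2) + ε * ‖ζ‖ ^ 2 - 1 / 2 * (δ * ‖ζ‖ ^ 2)
        ≤ - (b / 2 * ‖ζ‖ ^ 2) := by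
      have : ε ≤ b / 2 := by nlinarith
      have := mul_le_mul_of_nonneg_right this (sq_nonneg ‖ζ‖)
      rw [hb] at this ⊢
      linarith
    linarith [hg₁.1]

end Local

/-! ### Strong convexity of the subproblem. -/

section Model

variable {n r : ℕ} {f h : MatSpace n r → ℝ} {X : MatSpace n r}
  {B : tangentSpace X →ₗ[ℝ] tangentSpace X} {σ : ℝ}

/-- The quadratic form `⟨(B + σ I)[V], V⟩`. -/
def modelCurv (B : tangentSpace X →ₗ[ℝ] tangentSpace X) (σ : ℝ) (V : tangentSpace X) : ℝ :=
  inner ℝ (B V) V + σ * ‖V‖ ^ 2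

theorem model_sub_zero (f h : MatSpace n r → ℝ) (B : tangentSpace X →ₗ[ℝ] tangentSpace X) (σ : ℝ)
    (V : tangentSpace X) :
    model f h X B σ V - model f h X B σ 0 = inner ℝ (gradient f X) (V : MatSpace n r)
      + 1 / 2 * modelCurv B σ V + (h (X + V) - h X) := by
  simp only [model, modelCurv, LinearMap.add_apply, LinearMap.smul_apply, LinearMap.id_apply,
    inner_add_left, real_inner_smul_left, real_inner_self_eq_norm_sq, map_zero,
    ZeroMemClass.coe_zero, inner_zero_right, add_zero]
  ring

theorem modelCurv_smul (B : tangentSpace X →ₗ[ℝ] tangentSpace X) (σ a : ℝ) (V : tangentSpace X) :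
    modelCurv B σ (a • V) = a ^ 2 * modelCurv B σ V := by
  have h : inner ℝ (a • B V) (a • V) = a ^ 2 * inner ℝ (B V) V := by
    rw [Submodule.coe_inner, Submodule.coe_inner, Submodule.coe_smul, Submodule.coe_smul,
      real_inner_smul_left, real_inner_smul_right]
    ring
  simp only [modelCurv, map_smul, h, norm_smul, mul_pow, Real.norm_eq_abs, sq_abs]
  ring

/-- Convexity of h along the segment from 0 to V; the quadratic part is computed exactly. -/
theorem model_smul_sub_le (hh : ConvexOn ℝ Set.univ h) {a : ℝ} (ha0 : 0 ≤ a) (ha1 : a ≤ 1)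
    (V : tangentSpace X) :
    model f h X B σ (a • V) - model f h X B σ 0 ≤
      a * (model f h X B σ V - model f h X B σ 0) - 1 / 2 * a * (1 - a) * modelCurv B σ V := by
  rw [model_sub_zero, model_sub_zero, modelCurv_smul, Submodule.coe_smul, real_inner_smul_right]
  have h1 := hh.2 (Set.mem_univ (X + V)) (Set.mem_univ X) ha0 (sub_nonneg.2 ha1) (by ring)
  rw [show a • (X + (V : MatSpace n r)) + (1 - a) • X = X + a • (V : MatSpace n r) by module,
    smul_eq_mul, smul_eq_mul] at h1
  linarith

/-- Compare V with tV, divide by 1 − t and let t → 1; no subgradients are needed. -/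
theorem model_sub_zero_le_of_isMin (hh : ConvexOn ℝ Set.univ h) {V : tangentSpace X}
    (hV : ∀ W, model f h X B σ V ≤ model f h X B σ W) :
    model f h X B σ V - model f h X B σ 0 ≤ -(1 / 2 * modelCurv B σ V) := by
  set q := modelCurv B σ V
  set d := model f h X B σ V - model f h X B σ 0
  have h1 : ∀ t ∈ Set.Ico (0 : ℝ) 1, d ≤ -(1 / 2 * (t * q)) := by
    intro t ht
    have h2 := model_smul_sub_le (f := f) (B := B) (σ := σ) hh ht.1 ht.2.le V
    have h3 := hV (t • V)
    have h4 : (1 - t) * d ≤ (1 - t) * -(1 / 2 * (t * q)) := by linarith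
    exact le_of_mul_le_mul_left h4 (by linarith [ht.2])
  have hc : Continuous fun t : ℝ => -(1 / 2 * (t * q)) := by fun_prop
  have ht := (hc.tendsto 1).mono_left (nhdsWithin_le_nhds (s := Set.Iio 1))
  rw [one_mul] at ht
  refine ge_of_tendsto ht ?_
  filter_upwards [Ico_mem_nhdsLT (zero_lt_one' ℝ)] with t ht using h1 t ht

theorem model_smul_sub_le_of_isMin (hh : ConvexOn ℝ Set.univ h) {V : tangentSpace X}
    (hV : ∀ W, model f h X B σ V ≤ model f h X B σ W) {a : ℝ} (ha0 : 0 ≤ a) (ha1 : a ≤ 1) :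
    model f h X B σ (a • V) - model f h X B σ 0 ≤
      -(a * modelCurv B σ V) + 1 / 2 * a ^ 2 * modelCurv B σ V := by
  have h1 := model_smul_sub_le (f := f) (B := B) (σ := σ) hh ha0 ha1 V
  have h2 := mul_le_mul_of_nonneg_left (model_sub_zero_le_of_isMin hh hV) ha0
  linarith

end Model

/-! ### First-order expansion with Lipschitz gradient. -/

section Smoothness

variable {E : Type*} [NormedAddCommGroup E] [InnerProductSpace ℝ E] [CompleteSpace E]

/-- Mean value inequality for f minus its linearization; it gives L rather than the sharp L/2, which
suffices here. -/
theorem abs_sub_sub_inner_gradient_le {f : E → ℝ} (hf : Differentiable ℝ f) {L : ℝ≥0}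
    (hL : LipschitzWith L (gradient f)) (x y : E) :
    |f y - f x - inner ℝ (gradient f x) (y - x)| ≤ L * ‖y - x‖ ^ 2 := by
  have hd : ∀ z ∈ segment ℝ x y, HasFDerivWithinAt
      (fun z => f z - innerSL ℝ (gradient f x) z)
      (innerSL ℝ (gradient f z - gradient f x)) (segment ℝ x y) z := by
    intro z _
    have h1 : HasFDerivAt f (innerSL ℝ (gradient f z)) z :=
      (hf z).hasGradientAt.hasFDerivAt
    rw [map_sub]
    exact (h1.sub (innerSL ℝ (gradient f x)).hasFDerivAt).hasFDerivWithinAt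
  have hb : ∀ z ∈ segment ℝ x y, ‖innerSL ℝ (gradient f z - gradient f x)‖ ≤ L * ‖y - x‖ := by
    intro z hz
    rw [innerSL_apply_norm]
    refine (hL.norm_sub_le z x).trans ?_
    have : ‖z - x‖ ≤ ‖y - x‖ := norm_sub_le_of_mem_segment hz
    gcongr
  have := (convex_segment x y).norm_image_sub_le_of_norm_hasFDerivWithin_le hd hb
    (left_mem_segment ℝ x y) (right_mem_segment ℝ x y)
  simp only [innerSL_apply_apply, Real.norm_eq_abs] at this
  rw [inner_sub_right]
  calc _ = _ := by congr 1; ring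
    _ ≤ _ := this
    _ = _ := by ring

end Smoothness

/-! ### Uniform bounds along the retraction. -/

section Retraction

variable {n r : ℕ} {R : MatSpace n r → MatSpace n r → MatSpace n r} {M₂ : ℝ}

/-- For ‖ξ‖ ≤ 1 the quadratic error is at most linear; for ‖ξ‖ ≥ 1 the diameter bound 2√r suffices.
-/
theorem IsRetraction.exists_norm_sub_le (hR : IsRetraction R) (hM₂_pos : 0 < M₂)
    (hM₂ : ∀ X ∈ stiefel n r, ∀ ξ ∈ tangentSpace X, ‖R X ξ - X - ξ‖ ≤ M₂ * ‖ξ‖ ^ 2) :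
    ∃ M₁ : ℝ, 0 < M₁ ∧ ∀ X ∈ stiefel n r, ∀ ξ ∈ tangentSpace X, ‖R X ξ - X‖ ≤ M₁ * ‖ξ‖ := by
  have hs : 0 ≤ √(r : ℝ) := Real.sqrt_nonneg _
  refine ⟨1 + M₂ + 2 * √r, by positivity, fun X hX ξ hξ => ?_⟩
  have hn := norm_nonneg ξ
  rcases le_total ‖ξ‖ 1 with h1 | h1
  · have h2 := hM₂ X hX ξ hξ
    have h3 : ‖R X ξ - X‖ ≤ ‖R X ξ - X - ξ‖ + ‖ξ‖ := by
      simpa using norm_add_le (R X ξ - X - ξ) ξ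
    have h4 : M₂ * ‖ξ‖ ^ 2 ≤ M₂ * ‖ξ‖ := by
      refine mul_le_mul_of_nonneg_left ?_ hM₂_pos.le
      nlinarith
    nlinarith [mul_nonneg hs hn]
  · have h2 := norm_sub_le (R X ξ) X
    rw [norm_of_mem_stiefel hX, norm_of_mem_stiefel (hR.mapsTo X hX ξ hξ)] at h2
    nlinarith [mul_nonneg hM₂_pos.le hn]

variable {f h : MatSpace n r → ℝ} {L Lh : ℝ≥0}

theorem exists_norm_gradient_le (hL : LipschitzWith L (gradient f)) :
    ∃ C : ℝ, 0 < C ∧ ∀ X ∈ stiefel n r, ‖gradient f X‖ ≤ C := by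
  obtain ⟨C, hC⟩ := isCompact_stiefel.exists_bound_of_continuousOn hL.continuous.continuousOn
  exact ⟨max C 1, by positivity, fun X hX => (hC X hX).trans (le_max_left _ _)⟩

/-- The descent inequality along the retraction. -/
theorem IsRetraction.exists_objective_le (hR : IsRetraction R) (hM₂_pos : 0 < M₂)
    (hM₂ : ∀ X ∈ stiefel n r, ∀ ξ ∈ tangentSpace X, ‖R X ξ - X - ξ‖ ≤ M₂ * ‖ξ‖ ^ 2)
    (hf : Differentiable ℝ f) (hL : LipschitzWith L (gradient f)) (hh : LipschitzWith Lh h) :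
    ∃ c : ℝ, 0 < c ∧ ∀ X ∈ stiefel n r, ∀ ξ ∈ tangentSpace X,
      (f + h) (R X ξ) ≤ (f + h) X + inner ℝ (gradient f X) ξ + (h (X + ξ) - h X) + c * ‖ξ‖ ^ 2 := by
  obtain ⟨M₁, hM₁, hRM⟩ := hR.exists_norm_sub_le hM₂_pos hM₂
  obtain ⟨C, hC, hgC⟩ := exists_norm_gradient_le hL
  refine ⟨C * M₂ + L * M₁ ^ 2 + Lh * M₂, by positivity, fun X hX ξ hξ => ?_⟩
  have h1 := (abs_le.1 (abs_sub_sub_inner_gradient_le hf hL X (R X ξ))).2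
  have h2 := hM₂ X hX ξ hξ
  have h3 : (L : ℝ) * ‖R X ξ - X‖ ^ 2 ≤ L * (M₁ * ‖ξ‖) ^ 2 := by
    have := hRM X hX ξ hξ
    gcongr
  have h4 : inner ℝ (gradient f X) (R X ξ - X) ≤ inner ℝ (gradient f X) ξ + C * (M₂ * ‖ξ‖ ^ 2) := by
    have h5 := real_inner_le_norm (gradient f X) (R X ξ - X - ξ)
    have h6 : ‖gradient f X‖ * ‖R X ξ - X - ξ‖ ≤ C * (M₂ * ‖ξ‖ ^ 2) :=
      mul_le_mul (hgC X hX) h2 (norm_nonneg _) hC.le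
    rw [inner_sub_right] at h5
    linarith
  rw [sub_sub] at h2
  have h7 := hh.le_add_of_norm_sub_le h2
  simp only [Pi.add_apply]
  linarith

/-- Needed by the window argument to pass limits of values backwards across short steps. -/
theorem IsRetraction.exists_abs_objective_sub_le (hR : IsRetraction R) (hM₂_pos : 0 < M₂)
    (hM₂ : ∀ X ∈ stiefel n r, ∀ ξ ∈ tangentSpace X, ‖R X ξ - X - ξ‖ ≤ M₂ * ‖ξ‖ ^ 2)
    (hf : Differentiable ℝ f) (hL : LipschitzWith L (gradient f)) (hh : LipschitzWith Lh h) :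
    ∃ C : ℝ, 0 < C ∧ ∀ X ∈ stiefel n r, ∀ ξ ∈ tangentSpace X,
      |(f + h) (R X ξ) - (f + h) X| ≤ C * ‖ξ‖ := by
  obtain ⟨M₁, hM₁, hRM⟩ := hR.exists_norm_sub_le hM₂_pos hM₂
  obtain ⟨C, hC, hgC⟩ := exists_norm_gradient_le hL
  have hs : 0 ≤ √(r : ℝ) := Real.sqrt_nonneg _
  refine ⟨(C + L * (2 * √r) + Lh) * M₁, by positivity, fun X hX ξ hξ => ?_⟩
  have h1 := abs_sub_sub_inner_gradient_le hf hL X (R X ξ)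
  have h2 := norm_sub_le (R X ξ) X
  rw [norm_of_mem_stiefel hX, norm_of_mem_stiefel (hR.mapsTo X hX ξ hξ)] at h2
  have h3 := hh.norm_sub_le (R X ξ) X
  rw [Real.norm_eq_abs] at h3
  have h4 := (abs_real_inner_le_norm (gradient f X) (R X ξ - X)).trans
    (mul_le_mul_of_nonneg_right (hgC X hX) (norm_nonneg _))
  have h5 : (L : ℝ) * ‖R X ξ - X‖ ^ 2 ≤ L * (2 * √r) * ‖R X ξ - X‖ := by
    rw [pow_two, ← mul_assoc]
    gcongr
    linarith
  have h6 : |(f + h) (R X ξ) - (f + h) X| ≤ (C + L * (2 * √r) + Lh) * ‖R X ξ - X‖ := by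
    have heq : (f + h) (R X ξ) - (f + h) X = (f (R X ξ) - f X
        - inner ℝ (gradient f X) (R X ξ - X)) + inner ℝ (gradient f X) (R X ξ - X)
        + (h (R X ξ) - h X) := by simp only [Pi.add_apply]; ring
    rw [heq]
    refine (abs_add_three _ _ _).trans ?_
    linarith
  refine h6.trans ?_
  rw [mul_assoc]
  have := hRM X hX ξ hξ
  gcongr

end Retraction

/-! ### Termination of the inner loops and the accepted steps. -/

section Run

variable {n r : ℕ} {P : Params} {f h : MatSpace n r → ℝ}
  {R : MatSpace n r → MatSpace n r → MatSpace n r} {s : Trace n r} {κ₁ c : ℝ}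

theorem le_windowMax (F : MatSpace n r → ℝ) (X : ℕ → MatSpace n r) {m k j : ℕ}
    (h1 : k - m ≤ j) (h2 : j ≤ k) : F (X j) ≤ windowMax F X m k :=
  Finset.le_sup' (fun j => F (X j)) (Finset.mem_Icc.2 ⟨h1, h2⟩)

theorem trial_objective_le
    (hc : ∀ X ∈ stiefel n r, ∀ ξ ∈ tangentSpace X, (f + h) (R X ξ) ≤ (f + h) X
      + inner ℝ (gradient f X) ξ + (h (X + ξ) - h X) + c * ‖ξ‖ ^ 2)
    {X : MatSpace n r} (hX : X ∈ stiefel n r) (B : tangentSpace X →ₗ[ℝ] tangentSpace X) (σ a : ℝ)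
    (V : tangentSpace X) :
    (f + h) (R X (a • (V : MatSpace n r))) ≤ (f + h) X +
      (model f h X B σ (a • V) - model f h X B σ 0)
      - 1 / 2 * a ^ 2 * modelCurv B σ V + c * a ^ 2 * ‖V‖ ^ 2 := by
  have h1 := hc X hX (a • (V : MatSpace n r)) (a • V).2
  rw [model_sub_zero, modelCurv_smul, Submodule.coe_smul]
  rw [norm_smul, mul_pow, Real.norm_eq_abs, sq_abs, ← Submodule.coe_norm] at h1
  linarith

/-- The terms ±½a²q, q the model curvature, cancel between `trial_objective_le` and minimality,
leaving F(X) − aq + ca²‖V‖². If ca ≤ κ₁/2, the last term uses up at most half of a⟨BV, V⟩. -/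
theorem lineSearch_of_le (hh : ConvexOn ℝ Set.univ h)
    (hB : ∀ (k : ℕ) (V : tangentSpace (s.X k)), κ₁ * ‖V‖ ^ 2 ≤ inner ℝ (s.B k V) V)
    (hκ₁ : 0 < κ₁)
    (hc : ∀ X ∈ stiefel n r, ∀ ξ ∈ tangentSpace X, (f + h) (R X ξ) ≤ (f + h) X
      + inner ℝ (gradient f X) ξ + (h (X + ξ) - h X) + c * ‖ξ‖ ^ 2)
    {k i : ℕ} (hX : s.X k ∈ stiefel n r) (hreg : 0 ≤ s.reg P k i)
    (hmin : ∀ W, s.phi P f h k i (s.V k i) ≤ s.phi P f h k i W)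
    {a : ℝ} (ha0 : 0 ≤ a) (ha1 : a ≤ 1) (hac : c * a ≤ κ₁ / 2) :
    s.LineSearch P f h R k i a := by
  have h1 := trial_objective_le hc hX (s.B k) (s.reg P k i) a (s.V k i)
  have h2 := model_smul_sub_le_of_isMin hh hmin ha0 ha1
  have h3 := le_windowMax (f + h) s.X (m := P.memory) (Nat.sub_le k _) le_rfl
  have h4 := hB k (s.V k i)
  rw [modelCurv] at h1 h2
  have hv := sq_nonneg ‖s.V k i‖
  set v := ‖s.V k i‖ ^ 2
  set b : ℝ := inner ℝ (s.B k (s.V k i)) (s.V k i)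
  change _ ≤ _ - 1 / 2 * P.lsσ * a * b
  have h5 : a * (c * a * v) ≤ a * (b / 2) := by
    refine mul_le_mul_of_nonneg_left ?_ ha0
    have := mul_le_mul_of_nonneg_right hac hv
    linarith
  have h6 : 0 ≤ a * (s.reg P k i * v) := mul_nonneg ha0 (mul_nonneg hreg hv)
  have h7 : 0 ≤ (1 - P.lsσ) * (a * b) := by
    have := mul_nonneg hκ₁.le hv
    exact mul_nonneg (by linarith [P.lsσ_lt_one]) (mul_nonneg ha0 (by linarith))
  have h8 : (f + h) (s.trial R k i a) = (f + h) (R (s.X k) (a • (s.V k i : MatSpace n r))) := rfl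
  linarith

/-- Backtracking terminates, with a stepsize bounded below. -/
theorem IsRun.stepsize_spec (hs : IsRun P f h R s) (hh : ConvexOn ℝ Set.univ h)
    (hB : ∀ (k : ℕ) (V : tangentSpace (s.X k)), κ₁ * ‖V‖ ^ 2 ≤ inner ℝ (s.B k V) V)
    (hκ₁ : 0 < κ₁) (hc0 : 0 < c)
    (hc : ∀ X ∈ stiefel n r, ∀ ξ ∈ tangentSpace X, (f + h) (R X ξ) ≤ (f + h) X
      + inner ℝ (gradient f X) ξ + (h (X + ξ) - h X) + c * ‖ξ‖ ^ 2)
    {k i : ℕ} (hX : s.X k ∈ stiefel n r) (hreg : 0 ≤ s.reg P k i)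
    (hr : s.Reached P f h R k i) :
    min 1 (P.lsγ * (κ₁ / (2 * c))) ≤ s.α k i ∧ s.α k i ≤ 1 ∧
      s.LineSearch P f h R k i (s.α k i) := by
  classical
  have hγ0 := P.lsγ_pos
  have hls : ∀ N : ℕ, c * P.lsγ ^ N ≤ κ₁ / 2 → s.LineSearch P f h R k i (P.lsγ ^ N) := fun N hN =>
    lineSearch_of_le hh hB hκ₁ hc hX hreg (hs.solve k i hr) (by positivity)
      (pow_le_one₀ hγ0.le P.lsγ_lt_one.le) hN
  have hex : ∃ N : ℕ, s.LineSearch P f h R k i (P.lsγ ^ N) := by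
    obtain ⟨N, hN⟩ := exists_pow_lt_of_lt_one (show 0 < κ₁ / (2 * c) by positivity)
      P.lsγ_lt_one
    refine ⟨N, hls N ?_⟩
    rw [lt_div_iff₀ (by positivity)] at hN
    linarith
  have hα := hs.stepsize k i hr (Nat.find hex)
    ⟨Nat.find_spec hex, fun N hN => Nat.find_min' hex hN⟩
  rw [hα]
  refine ⟨?_, pow_le_one₀ hγ0.le P.lsγ_lt_one.le, Nat.find_spec hex⟩
  rcases Nat.eq_zero_or_pos (Nat.find hex) with h0 | h0
  · rw [h0, pow_zero]; exact min_le_left _ _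
  · refine (min_le_right _ _).trans ?_
    -- The preceding, larger stepsize failed the test, so it exceeded κ₁/(2c).
    have h1 : ¬ c * P.lsγ ^ (Nat.find hex - 1) ≤ κ₁ / 2 := fun h1 =>
      Nat.find_min hex (Nat.sub_lt h0 one_pos) (hls _ h1)
    rw [← Nat.sub_add_cancel h0, pow_succ, mul_comm]
    refine mul_le_mul_of_nonneg_right ?_ hγ0.le
    change _ ≤ P.lsγ ^ (Nat.find hex - 1)
    rw [div_le_iff₀ (by positivity)]
    linarith

theorem modelCurv_pos {X : MatSpace n r} {B : tangentSpace X →ₗ[ℝ] tangentSpace X} {σ : ℝ}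
    {V : tangentSpace X} (hκ₁ : 0 < κ₁) (hB : κ₁ * ‖V‖ ^ 2 ≤ inner ℝ (B V) V) (hσ : 0 ≤ σ)
    (hV : ‖V‖ ≠ 0) : 0 < modelCurv B σ V := by
  have h1 : 0 < κ₁ * ‖V‖ ^ 2 := by positivity
  have h2 : 0 ≤ σ * ‖V‖ ^ 2 := by positivity
  rw [modelCurv]
  linarith

theorem model_smul_sub_neg {X : MatSpace n r} {B : tangentSpace X →ₗ[ℝ] tangentSpace X} {σ : ℝ}
    (hh : ConvexOn ℝ Set.univ h) {V : tangentSpace X}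
    (hmin : ∀ W, model f h X B σ V ≤ model f h X B σ W) (hq : 0 < modelCurv B σ V)
    {a : ℝ} (ha0 : 0 < a) (ha1 : a ≤ 1) :
    model f h X B σ (a • V) - model f h X B σ 0 < 0 := by
  have h1 := model_smul_sub_le_of_isMin hh hmin ha0.le ha1
  have h2 : 0 < a * modelCurv B σ V := mul_pos ha0 hq
  nlinarith

/-- A pass with a large enough regularization parameter is accepted. -/
theorem IsRun.le_ratio (hs : IsRun P f h R s) (hh : ConvexOn ℝ Set.univ h)
    (hB : ∀ (k : ℕ) (V : tangentSpace (s.X k)), κ₁ * ‖V‖ ^ 2 ≤ inner ℝ (s.B k V) V)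
    (hκ₁ : 0 < κ₁) (hc0 : 0 < c)
    (hc : ∀ X ∈ stiefel n r, ∀ ξ ∈ tangentSpace X, (f + h) (R X ξ) ≤ (f + h) X
      + inner ℝ (gradient f X) ξ + (h (X + ξ) - h X) + c * ‖ξ‖ ^ 2)
    (hV : ∀ k i : ℕ, s.Reached P f h R k i → ‖s.V k i‖ ≠ 0)
    {k i : ℕ} (hX : s.X k ∈ stiefel n r) (hreg : 2 * c ≤ s.reg P k i)
    (hr : s.Reached P f h R k i) : P.η₁ ≤ s.ratio P f h R k i := by
  have hreg0 : 0 ≤ s.reg P k i := by linarith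
  obtain ⟨ha, ha1, -⟩ := hs.stepsize_spec hh hB hκ₁ hc0 hc hX hreg0 hr
  have hγ0 := P.lsγ_pos
  have ha0 : 0 < s.α k i := lt_of_lt_of_le (by positivity) ha
  have hmin := hs.solve k i hr
  have hneg := model_smul_sub_neg hh hmin (modelCurv_pos hκ₁ (hB k _) hreg0 (hV k i hr)) ha0 ha1
  -- The ratio is even at least 1: curvature at least 2c‖V‖² absorbs the error ca²‖V‖², so the
  -- actual decrease is no less than the predicted one.
  refine (P.η₁_lt_η₂.trans P.η₂_lt_one).le.trans ((one_le_div_of_neg hneg).2 ?_)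
  have h1 := trial_objective_le hc hX (s.B k) (s.reg P k i) (s.α k i) (s.V k i)
  have h3 := le_windowMax (f + h) s.X (m := P.memory) (Nat.sub_le k _) le_rfl
  have h4 : 2 * c * ‖s.V k i‖ ^ 2 ≤ modelCurv (s.B k) (s.reg P k i) (s.V k i) := by
    have := mul_le_mul_of_nonneg_right hreg (sq_nonneg ‖s.V k i‖)
    have := hB k (s.V k i)
    have : 0 ≤ κ₁ * ‖s.V k i‖ ^ 2 := by positivity
    rw [modelCurv]
    linarith
  have h5 := mul_le_mul_of_nonneg_left h4 (sq_nonneg (s.α k i))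
  have h6 : (f + h) (s.trial R k i (s.α k i))
    = (f + h) (R (s.X k) (s.α k i • (s.V k i : MatSpace n r))) := rfl
  rw [h6]
  linarith

/-- The inner loop terminates. -/
theorem IsRun.exists_accepted (hs : IsRun P f h R s) (hh : ConvexOn ℝ Set.univ h)
    (hB : ∀ (k : ℕ) (V : tangentSpace (s.X k)), κ₁ * ‖V‖ ^ 2 ≤ inner ℝ (s.B k V) V)
    (hκ₁ : 0 < κ₁) (hc0 : 0 < c)
    (hc : ∀ X ∈ stiefel n r, ∀ ξ ∈ tangentSpace X, (f + h) (R X ξ) ≤ (f + h) X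
      + inner ℝ (gradient f X) ξ + (h (X + ξ) - h X) + c * ‖ξ‖ ^ 2)
    (hV : ∀ k i : ℕ, s.Reached P f h R k i → ‖s.V k i‖ ≠ 0)
    {k : ℕ} (hX : s.X k ∈ stiefel n r) (hσ : 0 < s.σ k) :
    ∃ i, s.Reached P f h R k i ∧ P.η₁ ≤ s.ratio P f h R k i ∧ 0 < s.reg P k i ∧
      s.reg P k i ≤ max (s.σ k) (P.γ₂ * (2 * c)) := by
  classical
  have hγ1 := P.one_lt_γ₂
  have hregpos : ∀ i, 0 < s.reg P k i := fun i => by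
    have : 0 < P.γ₂ := by linarith
    unfold Trace.reg; positivity
  have hex : ∃ i, P.η₁ ≤ s.ratio P f h R k i := by
    by_contra! hno
    obtain ⟨i, hi⟩ := pow_unbounded_of_one_lt (2 * c / s.σ k) hγ1
    rw [div_lt_iff₀ hσ] at hi
    exact (hno i).not_ge (hs.le_ratio hh hB hκ₁ hc0 hc hV hX hi.le fun j _ => hno j)
  have hreached : ∀ i ≤ Nat.find hex, s.Reached P f h R k i := fun i hi j hj =>
    not_le.1 (Nat.find_min hex (hj.trans_le hi))
  refine ⟨Nat.find hex, hreached _ le_rfl, Nat.find_spec hex, hregpos _, ?_⟩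
  rcases Nat.eq_zero_or_pos (Nat.find hex) with h0 | h0
  · rw [h0]; simp [Trace.reg]
  · refine le_max_of_le_right ?_
    -- The preceding pass was rejected, so its parameter was below 2c, and only one factor γ₂
    -- follows.
    have h1 : s.reg P k (Nat.find hex - 1) < 2 * c := by
      by_contra! h1
      exact Nat.find_min hex (Nat.sub_lt h0 one_pos)
        (hs.le_ratio hh hB hκ₁ hc0 hc hV hX h1 (hreached _ (Nat.sub_le _ _)))
    have h2 : s.reg P k (Nat.find hex) = P.γ₂ * s.reg P k (Nat.find hex - 1) := by
      unfold Trace.reg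
      conv_lhs => rw [← Nat.sub_add_cancel h0, pow_succ]
      ring
    rw [h2]
    gcongr

/-- The iterates stay on the Stiefel manifold and the regularization parameters stay bounded. -/
theorem IsRun.mem_stiefel_and_σ_le (hs : IsRun P f h R s) (hR : IsRetraction R)
    (hh : ConvexOn ℝ Set.univ h)
    (hB : ∀ (k : ℕ) (V : tangentSpace (s.X k)), κ₁ * ‖V‖ ^ 2 ≤ inner ℝ (s.B k V) V)
    (hκ₁ : 0 < κ₁) (hc0 : 0 < c)
    (hc : ∀ X ∈ stiefel n r, ∀ ξ ∈ tangentSpace X, (f + h) (R X ξ) ≤ (f + h) X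
      + inner ℝ (gradient f X) ξ + (h (X + ξ) - h X) + c * ‖ξ‖ ^ 2)
    (hV : ∀ k i : ℕ, s.Reached P f h R k i → ‖s.V k i‖ ≠ 0) (k : ℕ) :
    s.X k ∈ stiefel n r ∧ 0 < s.σ k ∧ s.σ k ≤ max P.σ₀ (P.γ₂ * (2 * c)) := by
  induction k with
  | zero => exact ⟨hs.init_mem, hs.init_σ ▸ P.σ₀_pos, hs.init_σ ▸ le_max_left _ _⟩
  | succ k ih =>
    obtain ⟨hX, hσ0, hσ1⟩ := ih
    obtain ⟨i, hr, hρ, hreg0, hreg⟩ := hs.exists_accepted hh hB hκ₁ hc0 hc hV hX hσ0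
    have hreg' := hreg.trans (max_le hσ1 (le_max_right _ _))
    refine ⟨?_, ?_⟩
    · rw [hs.accept_X k i hr hρ]
      exact hR.mapsTo _ hX _ (s.α k i • s.V k i).2
    · rw [hs.accept_σ k i hr hρ]
      split_ifs
      · exact ⟨mul_pos P.γ₁_pos hreg0,
          (mul_le_of_le_one_left hreg0.le P.γ₁_lt_one.le).trans hreg'⟩
      · exact ⟨hreg0, hreg'⟩

/-- The accepted step of an outer iteration. -/
theorem IsRun.exists_step (hs : IsRun P f h R s) (hR : IsRetraction R)
    (hh : ConvexOn ℝ Set.univ h)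
    (hB : ∀ (k : ℕ) (V : tangentSpace (s.X k)), κ₁ * ‖V‖ ^ 2 ≤ inner ℝ (s.B k V) V)
    (hκ₁ : 0 < κ₁) (hc0 : 0 < c)
    (hc : ∀ X ∈ stiefel n r, ∀ ξ ∈ tangentSpace X, (f + h) (R X ξ) ≤ (f + h) X
      + inner ℝ (gradient f X) ξ + (h (X + ξ) - h X) + c * ‖ξ‖ ^ 2)
    (hV : ∀ k i : ℕ, s.Reached P f h R k i → ‖s.V k i‖ ≠ 0) (k : ℕ) :
    ∃ (V : tangentSpace (s.X k)) (a σ : ℝ), min 1 (P.lsγ * (κ₁ / (2 * c))) ≤ a ∧ a ≤ 1 ∧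
      0 < σ ∧ σ ≤ max P.σ₀ (P.γ₂ * (2 * c)) ∧
      (∀ W, model f h (s.X k) (s.B k) σ V ≤ model f h (s.X k) (s.B k) σ W) ∧
      s.X (k + 1) = R (s.X k) (a • (V : MatSpace n r)) ∧
      (f + h) (s.X (k + 1)) ≤ windowMax (f + h) s.X P.memory k
        - 1 / 2 * P.lsσ * a * inner ℝ (s.B k V) V ∧
      (f + h) (s.X (k + 1)) ≤ windowMax (f + h) s.X P.memory k
        + P.η₁ * (model f h (s.X k) (s.B k) σ (a • V) - model f h (s.X k) (s.B k) σ 0) := by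
  obtain ⟨hX, hσ0, hσ1⟩ := hs.mem_stiefel_and_σ_le hR hh hB hκ₁ hc0 hc hV k
  obtain ⟨i, hr, hρ, hreg0, hreg⟩ := hs.exists_accepted hh hB hκ₁ hc0 hc hV hX hσ0
  obtain ⟨ha, ha1, hls⟩ := hs.stepsize_spec hh hB hκ₁ hc0 hc hX hreg0.le hr
  have hγ0 := P.lsγ_pos
  have ha0 : 0 < s.α k i := lt_of_lt_of_le (by positivity) ha
  have hmin := hs.solve k i hr
  have hneg := model_smul_sub_neg hh hmin (modelCurv_pos hκ₁ (hB k _) hreg0.le (hV k i hr)) ha0 ha1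
  have hX1 := hs.accept_X k i hr hρ
  refine ⟨s.V k i, s.α k i, s.reg P k i, ha, ha1, hreg0, hreg.trans (max_le hσ1 (le_max_right _ _)),
    hmin, hX1, ?_, ?_⟩
  · rw [hX1]; exact hls
  · have h1 := (le_div_iff_of_neg hneg).1 hρ
    rw [hX1]
    linarith

end Run

/-! ### Nonmonotone sequences: convergence and rates. -/

section Sequences

open Filter

variable {n r m : ℕ} {F : MatSpace n r → ℝ} {X : ℕ → MatSpace n r}

theorem exists_eq_windowMax (F : MatSpace n r → ℝ) (X : ℕ → MatSpace n r) (m k : ℕ) :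
    ∃ j, k - m ≤ j ∧ j ≤ k ∧ windowMax F X m k = F (X j) := by
  obtain ⟨j, hj, h⟩ := Finset.exists_mem_eq_sup' (Finset.nonempty_Icc.mpr (Nat.sub_le k m))
    fun j => F (X j)
  exact ⟨j, (Finset.mem_Icc.1 hj).1, (Finset.mem_Icc.1 hj).2, h⟩

theorem antitone_windowMax (h : ∀ k, F (X (k + 1)) ≤ windowMax F X m k) :
    Antitone (windowMax F X m) := by
  refine antitone_nat_of_succ_le fun k => ?_
  obtain ⟨j, h1, h2, h3⟩ := exists_eq_windowMax F X m (k + 1)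
  rw [h3]
  rcases Nat.lt_or_ge k j with hj | hj
  · rw [show j = k + 1 by omega]; exact h k
  · exact le_windowMax F X (by omega) hj

/-- A nonmonotone sufficient decrease forces convergence of the values and vanishing of the
steps. -/
theorem exists_tendsto_of_window_decrease {v : ℕ → ℝ} (hv : ∀ k, 0 ≤ v k) {c C : ℝ} (hc : 0 < c)
    (hdec : ∀ k, F (X (k + 1)) ≤ windowMax F X m k - c * v k ^ 2)
    (hlip : ∀ k, |F (X (k + 1)) - F (X k)| ≤ C * v k)
    (hbdd : BddBelow (Set.range fun k => F (X k))) :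
    ∃ l, Tendsto (fun k => F (X k)) atTop (𝓝 l) ∧ Tendsto v atTop (𝓝 0) := by
  have hanti : Antitone (windowMax F X m) := antitone_windowMax fun k => (hdec k).trans <| by
    have := mul_nonneg hc.le (sq_nonneg (v k)); linarith
  have hwb : BddBelow (Set.range (windowMax F X m)) := by
    obtain ⟨b, hb⟩ := hbdd
    refine ⟨b, ?_⟩
    rintro _ ⟨k, rfl⟩
    exact (hb ⟨k, rfl⟩).trans (le_windowMax F X (Nat.sub_le k m) le_rfl)
  have hw := tendsto_atTop_ciInf hanti hwb
  set l := ⨅ k, windowMax F X m k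
  have hvu : ∀ u : ℕ → ℕ, Tendsto u atTop atTop →
      Tendsto (fun k => F (X (u k + 1))) atTop (𝓝 l) → Tendsto (fun k => v (u k)) atTop (𝓝 0) := by
    intro u hu hF
    have h1 : Tendsto (fun k => (windowMax F X m (u k) - F (X (u k + 1))) / c) atTop (𝓝 0) := by
      simpa using ((hw.comp hu).sub hF).div_const c
    have h2 : Tendsto (fun k => v (u k) ^ 2) atTop (𝓝 0) := by
      refine squeeze_zero (fun k => sq_nonneg _) (fun k => ?_) h1
      rw [le_div_iff₀ hc]
      linarith [hdec (u k)]
    have h3 := (Real.continuous_sqrt.tendsto 0).comp h2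
    rw [Real.sqrt_zero] at h3
    exact h3.congr fun k => Real.sqrt_sq (hv _)
  -- If values along u tend to l, the decrease kills the steps leading there, so the values one
  -- index earlier also tend to l.
  have hstep : ∀ u : ℕ → ℕ, Tendsto u atTop atTop →
      Tendsto (fun k => F (X (u k))) atTop (𝓝 l) →
      Tendsto (fun k => F (X (u k - 1))) atTop (𝓝 l) := by
    intro u hu hF
    have hu' : Tendsto (fun k => u k - 1) atTop atTop := (tendsto_sub_atTop_nat 1).comp hu
    have hF' : Tendsto (fun k => F (X (u k - 1 + 1))) atTop (𝓝 l) := by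
      refine hF.congr' ?_
      filter_upwards [hu.eventually_ge_atTop 1] with k hk
      rw [Nat.sub_add_cancel hk]
    have h1 : Tendsto (fun k => C * v (u k - 1)) atTop (𝓝 0) := by
      simpa using (hvu _ hu' hF').const_mul C
    have h2 : Tendsto (fun k => F (X (u k - 1 + 1)) - F (X (u k - 1))) atTop (𝓝 0) :=
      squeeze_zero_norm (fun k => hlip _) h1
    simpa using hF'.sub h2
  choose j hj1 hj2 hj3 using exists_eq_windowMax F X m
  have hjm : Tendsto (fun k => j (k + m)) atTop atTop :=
    tendsto_atTop_mono (fun k => show k ≤ j (k + m) by have := hj1 (k + m); omega) tendsto_id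
  have hall : ∀ i, Tendsto (fun k => F (X (j (k + m) - i))) atTop (𝓝 l) := by
    intro i
    induction i with
    | zero => exact (hw.comp (tendsto_add_atTop_nat m)).congr fun k => hj3 (k + m)
    | succ i ih => exact hstep _ ((tendsto_sub_atTop_nat i).comp hjm) ih
  have hF : Tendsto (fun k => F (X k)) atTop (𝓝 l) := by
    -- Since k ≤ j(k+m) ≤ k + m, index k is a window maximizer moved back by one of the offsets 0,
    -- …, m.
    have hsum : Tendsto (fun k => ∑ i ∈ Finset.range (m + 1), |F (X (j (k + m) - i)) - l|)
        atTop (𝓝 0) := by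
      rw [← Finset.sum_const_zero (s := Finset.range (m + 1))]
      exact tendsto_finsetSum _ fun i _ => by simpa using ((hall i).sub_const l).abs
    rw [tendsto_iff_norm_sub_tendsto_zero]
    refine squeeze_zero (fun k => norm_nonneg _) (fun k => ?_) hsum
    have h1 := hj1 (k + m)
    have h2 := hj2 (k + m)
    have h3 := Finset.single_le_sum (f := fun i => |F (X (j (k + m) - i)) - l|)
      (fun i _ => abs_nonneg _) (Finset.mem_range.2 (show j (k + m) - k < m + 1 by omega))
    rwa [show j (k + m) - (j (k + m) - k) = k by omega] at h3
  exact ⟨l, hF, hvu id tendsto_id (hF.comp (tendsto_add_atTop_nat 1))⟩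

/-- A contraction of each value relative to the preceding window gives linear convergence. -/
theorem exists_rate_of_window_contraction {a τ₀ : ℝ} (h0 : 0 < τ₀) (h1 : τ₀ < 1) {K : ℕ}
    (hK : 0 ≤ windowMax F X m K - a)
    (h : ∀ k, K ≤ k → F (X (k + 1)) - a ≤ τ₀ * (windowMax F X m k - a)) :
    ∃ τ : ℝ, 0 < τ ∧ τ < 1 ∧
      ∀ k, K ≤ k → F (X k) - a ≤ τ ^ (k - K) * (windowMax F X m K - a) := by
  -- A factor τ₀ is gained relative to a value at most m + 1 indices earlier, so τ is its (m+1)-th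
  -- root.
  have hτ0 : 0 < τ₀ ^ (((m + 1 : ℕ) : ℝ)⁻¹) := Real.rpow_pos_of_pos h0 _
  have hτ1 : τ₀ ^ (((m + 1 : ℕ) : ℝ)⁻¹) < 1 := Real.rpow_lt_one h0.le h1 (by positivity)
  have hτm := Real.rpow_inv_natCast_pow h0.le (Nat.succ_ne_zero m)
  rw [Nat.succ_eq_add_one] at hτm
  set τ := τ₀ ^ (((m + 1 : ℕ) : ℝ)⁻¹)
  set D := windowMax F X m K - a
  have key : ∀ j, F (X (K + j)) - a ≤ τ ^ j * D := by
    intro j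
    induction j using Nat.strong_induction_on with
    | _ j ih =>
      rcases j with _ | j
      · have := le_windowMax F X (m := m) (Nat.sub_le K m) le_rfl
        simp only [add_zero, pow_zero, one_mul, D]
        linarith
      · obtain ⟨i, hi1, hi2, hi3⟩ := exists_eq_windowMax F X m (K + j)
        have hmono : ∀ p q : ℕ, p ≤ q → τ ^ q * D ≤ τ ^ p * D := fun p q hpq =>
          mul_le_mul_of_nonneg_right (pow_le_pow_of_le_one hτ0.le hτ1.le hpq) hK
        have hwin : windowMax F X m (K + j) - a ≤ τ ^ (j - m) * D := by
          rw [hi3]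
          rcases Nat.lt_or_ge i K with hiK | hiK
          -- An index below K lies in the window of K; then j < m and the truncated `j - m` is 0.
          · have := le_windowMax F X (m := m) (show K - m ≤ i by omega) hiK.le
            rw [show j - m = 0 by omega, pow_zero, one_mul]
            simp only [D]
            linarith
          · have := ih (i - K) (by omega)
            rw [Nat.add_sub_cancel' hiK] at this
            exact this.trans (hmono _ _ (by omega))
        calc _ ≤ τ₀ * (windowMax F X m (K + j) - a) := h (K + j) (Nat.le_add_right _ _)
          _ ≤ τ₀ * (τ ^ (j - m) * D) := mul_le_mul_of_nonneg_left hwin h0.le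
          _ = τ ^ (m + 1 + (j - m)) * D := by rw [← hτm, pow_add]; ring
          _ ≤ _ := hmono _ _ (by omega)
  refine ⟨τ, hτ0, hτ1, fun k hk => ?_⟩
  have := key (k - K)
  rwa [Nat.add_sub_cancel' hk] at this

/-- If the steps vanish, a cluster point with quadratic growth that attains the limit value is the
limit. -/
theorem tendsto_of_quadratic_growth {E : Type*} [NormedAddCommGroup E] {F : E → ℝ} {S : Set E}
    {x : E} {X : ℕ → E} {c : ℝ} (hc : 0 < c)
    (hgrowth : ∀ᶠ y in 𝓝 x, y ∈ S → F x + c * ‖y - x‖ ^ 2 ≤ F y) (hXS : ∀ k, X k ∈ S)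
    (hacc : MapClusterPt x atTop X) (hF : Tendsto (fun k => F (X k)) atTop (𝓝 (F x)))
    (hstep : Tendsto (fun k => ‖X (k + 1) - X k‖) atTop (𝓝 0)) : Tendsto X atTop (𝓝 x) := by
  obtain ⟨ρ, hρ, hball⟩ := Metric.eventually_nhds_iff_ball.1 hgrowth
  have hev1 : ∀ᶠ k in atTop, F (X k) < F x + c * (ρ / 2) ^ 2 :=
    hF.eventually_lt_const (by have : 0 < c * (ρ / 2) ^ 2 := by positivity
                               linarith)
  have hev2 : ∀ᶠ k in atTop, ‖X (k + 1) - X k‖ < ρ / 2 :=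
    hstep.eventually_lt_const (by positivity)
  obtain ⟨N, hN⟩ := eventually_atTop.1 (hev1.and hev2)
  obtain ⟨k₀, hk₀, hk₀b⟩ := (frequently_atTop.1
    (hacc.frequently (Metric.ball_mem_nhds x hρ))) N
  -- Growth confines an iterate in the ball to radius ρ/2, and the next step is shorter than ρ/2.
  have hin : ∀ k, k₀ ≤ k → X k ∈ Metric.ball x ρ := by
    intro k hk
    induction k, hk using Nat.le_induction with
    | base => exact hk₀b
    | succ k hk ih =>
      have h1 := hball _ ih (hXS k)
      obtain ⟨h2, h3⟩ := hN k (hk₀.trans hk)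
      have h4 : ‖X k - x‖ ^ 2 < (ρ / 2) ^ 2 := lt_of_mul_lt_mul_left (by linarith) hc.le
      have h5 : ‖X k - x‖ < ρ / 2 := lt_of_pow_lt_pow_left₀ 2 (by positivity) h4
      rw [mem_ball_iff_norm]
      have h6 : ‖X (k + 1) - x‖ ≤ ‖X (k + 1) - X k‖ + ‖X k - x‖ :=
        norm_sub_le_norm_sub_add_norm_sub _ _ _
      linarith
  rw [tendsto_iff_norm_sub_tendsto_zero]
  have h1 : Tendsto (fun k => (F (X k) - F x) / c) atTop (𝓝 0) := by
    simpa using (hF.sub_const (F x)).div_const c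
  have h2 : Tendsto (fun k => ‖X k - x‖ ^ 2) atTop (𝓝 0) := by
    refine squeeze_zero' (Eventually.of_forall fun k => sq_nonneg _) ?_ h1
    filter_upwards [eventually_ge_atTop k₀] with k hk
    rw [le_div_iff₀ hc]
    linarith [hball _ (hin k hk) (hXS k)]
  have h3 := (Real.continuous_sqrt.tendsto 0).comp h2
  rw [Real.sqrt_zero] at h3
  exact h3.congr fun k => Real.sqrt_sq (norm_nonneg _)

end Sequences

/-! ### Stationarity of the limit and contraction of the gap. -/

section Stationarity

variable {n r : ℕ} {f h : MatSpace n r → ℝ}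

/-- A convex model that is nonnegative up to a quadratic term is nonnegative. -/
theorem nonneg_of_nonneg_add_sq {E : Type*} [NormedAddCommGroup E] [InnerProductSpace ℝ E]
    {h : E → ℝ} (hh : ConvexOn ℝ Set.univ h) {g x w : E} {A : ℝ}
    (hw : ∀ t : ℝ, 0 ≤ inner ℝ g (t • w) + 1 / 2 * A * ‖t • w‖ ^ 2 + (h (x + t • w) - h x)) :
    0 ≤ inner ℝ g w + h (x + w) - h x := by
  -- Under w ↦ tw the quadratic term is O(t²), while by convexity the rest is at most linear in t;
  -- divide by t and let t → 0.
  have h1 : ∀ t ∈ Set.Ioc (0 : ℝ) 1,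
      0 ≤ (inner ℝ g w + h (x + w) - h x) + t * (1 / 2 * A * ‖w‖ ^ 2) := by
    intro t ht
    have h2 := hw t
    have h3 := hh.2 (Set.mem_univ (x + w)) (Set.mem_univ x) ht.1.le (sub_nonneg.2 ht.2) (by ring)
    rw [show t • (x + w) + (1 - t) • x = x + t • w by module, smul_eq_mul, smul_eq_mul] at h3
    rw [real_inner_smul_right, norm_smul, mul_pow, Real.norm_eq_abs, sq_abs] at h2
    refine le_of_mul_le_mul_left ?_ ht.1
    linarith
  have hc : Continuous fun t : ℝ =>
      (inner ℝ g w + h (x + w) - h x) + t * (1 / 2 * A * ‖w‖ ^ 2) := by fun_prop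
  have ht := (hc.tendsto 0).mono_left (nhdsWithin_le_nhds (s := Set.Ioi 0))
  rw [zero_mul, add_zero] at ht
  refine ge_of_tendsto ht ?_
  filter_upwards [Ioc_mem_nhdsGT (zero_lt_one' ℝ)] with t ht using h1 t ht

/-- A short minimizer of the model makes the point nearly stationary. -/
theorem neg_le_of_isMin_model {X : MatSpace n r} {B : tangentSpace X →ₗ[ℝ] tangentSpace X}
    {σ A C : ℝ} {Lh : ℝ≥0} (hh : LipschitzWith Lh h) (hC : ‖gradient f X‖ ≤ C)
    {V : tangentSpace X} (hmin : ∀ W, model f h X B σ V ≤ model f h X B σ W)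
    (hpos : 0 ≤ modelCurv B σ V) {W : tangentSpace X} (hA : modelCurv B σ W ≤ A * ‖W‖ ^ 2) :
    -((C + Lh) * ‖V‖) ≤ inner ℝ (gradient f X) (W : MatSpace n r) + 1 / 2 * A * ‖W‖ ^ 2
      + (h (X + W) - h X) := by
  have h1 := model_sub_zero f h B σ V
  have h2 := model_sub_zero f h B σ W
  have h3 := hmin W
  have h4 := (abs_le.1 ((abs_real_inner_le_norm (gradient f X) (V : MatSpace n r)).trans
    (mul_le_mul_of_nonneg_right hC (norm_nonneg _)))).1
  have h5 := hh.norm_sub_le (X + V) X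
  rw [Real.norm_eq_abs, add_sub_cancel_left] at h5
  have h6 := (abs_le.1 h5).1
  rw [← Submodule.coe_norm] at h4 h6
  linarith

/-- The contraction of the objective gap in one step that starts near the limit point. -/
theorem objective_contraction {R : MatSpace n r → MatSpace n r → MatSpace n r}
    (hh : ConvexOn ℝ Set.univ h) {c : ℝ}
    (hc : ∀ X ∈ stiefel n r, ∀ ξ ∈ tangentSpace X, (f + h) (R X ξ) ≤ (f + h) X
      + inner ℝ (gradient f X) ξ + (h (X + ξ) - h X) + c * ‖ξ‖ ^ 2) (hc0 : 0 < c)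
    {X : MatSpace n r} (hX : X ∈ stiefel n r) {B : tangentSpace X →ₗ[ℝ] tangentSpace X}
    {σ κ₁ A c₂ lam η a a₀ w F₀ z : ℝ} (hκ₁ : 0 < κ₁) (hη : 0 < η)
    (hlow : ∀ V, κ₁ * ‖V‖ ^ 2 ≤ modelCurv B σ V) (hup : ∀ V, modelCurv B σ V ≤ A * ‖V‖ ^ 2)
    {V W : tangentSpace X} (hmin : ∀ W, model f h X B σ V ≤ model f h X B σ W)
    (ha₀ : 0 < a₀) (ha : a₀ ≤ a) (ha1 : a ≤ 1) (hlam0 : 0 < lam) (hlam1 : lam ≤ 1)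
    (hA : 0 ≤ A) (hlamA : 2 * lam * A ≤ c₂) (hW : ‖W‖ ≤ 2 * z)
    (hWm : inner ℝ (gradient f X) (W : MatSpace n r) + h (X + W) - h X
      ≤ F₀ - (f + h) X - c₂ * z ^ 2)
    (hdec : (f + h) (R X (a • (V : MatSpace n r))) ≤ w
      + η * (model f h X B σ (a • V) - model f h X B σ 0)) :
    (f + h) (R X (a • (V : MatSpace n r))) - F₀
      ≤ (1 / lam + 2 * c / κ₁) / ((1 / lam + 2 * c / κ₁) + η * a₀) * (w - F₀) := by
  have ha0 : 0 < a := ha₀.trans_le ha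
  set d := model f h X B σ 0 - model f h X B σ V with hd
  have hd1 : κ₁ * ‖V‖ ^ 2 ≤ 2 * d := by
    have := model_sub_zero_le_of_isMin hh hmin
    linarith [hlow V]
  have hd0 : 0 ≤ d := by
    have : 0 ≤ κ₁ * ‖V‖ ^ 2 := by positivity
    linarith
  have hd2 : lam * ((f + h) X - F₀) ≤ d := by
    -- At λW the curvature costs at most 2λ²Az² ≤ λc₂z², which the second-order gain in `hWm` pays
    -- for.
    have h1 := hmin (lam • W)
    have h2 := model_smul_sub_le (f := f) (B := B) (σ := σ) hh hlam0.le hlam1 W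
    rw [model_sub_zero _ _ _ _ W] at h2
    have h3 : ‖W‖ ^ 2 ≤ 4 * z ^ 2 := by nlinarith [norm_nonneg W]
    have h4 : lam ^ 2 * modelCurv B σ W ≤ lam ^ 2 * (A * (4 * z ^ 2)) :=
      mul_le_mul_of_nonneg_left ((hup W).trans (mul_le_mul_of_nonneg_left h3 hA)) (sq_nonneg _)
    have h5 := mul_le_mul_of_nonneg_left hWm hlam0.le
    have h6 : lam * (2 * lam * A * z ^ 2) ≤ lam * (c₂ * z ^ 2) :=
      mul_le_mul_of_nonneg_left (mul_le_mul_of_nonneg_right hlamA (sq_nonneg z)) hlam0.le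
    linarith
  have hnext : (f + h) (R X (a • (V : MatSpace n r))) - F₀ ≤ (1 / lam + 2 * c / κ₁) * d := by
    have h1 := trial_objective_le hc hX B σ a V
    have h2 := model_smul_sub_le_of_isMin hh hmin ha0.le ha1
    have h3 : 0 ≤ a * modelCurv B σ V :=
      mul_nonneg ha0.le ((by positivity : 0 ≤ κ₁ * ‖V‖ ^ 2).trans (hlow V))
    have h4 : c * a ^ 2 * ‖V‖ ^ 2 ≤ 2 * c / κ₁ * d := by
      have h5 : ‖V‖ ^ 2 ≤ 2 * d / κ₁ := by rw [le_div_iff₀ hκ₁]; linarith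
      have h6 : a ^ 2 ≤ 1 := pow_le_one₀ ha0.le ha1
      calc c * a ^ 2 * ‖V‖ ^ 2 ≤ c * 1 * (2 * d / κ₁) := by gcongr
        _ = _ := by ring
    have h7 : (f + h) X - F₀ ≤ 1 / lam * d := by
      rw [one_div, ← div_eq_inv_mul, le_div_iff₀ hlam0]
      linarith
    linarith
  have hnext2 : (f + h) (R X (a • (V : MatSpace n r))) - F₀ ≤ (w - F₀) - η * a₀ * d := by
    have h1 := model_smul_sub_le (f := f) (B := B) (σ := σ) hh ha0.le ha1 V
    have h2 : 0 ≤ 1 / 2 * a * (1 - a) * modelCurv B σ V := by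
      have := (by positivity : 0 ≤ κ₁ * ‖V‖ ^ 2).trans (hlow V)
      have := sub_nonneg.2 ha1
      positivity
    have h3 : a₀ * d ≤ a * d := mul_le_mul_of_nonneg_right ha hd0
    have h4 : model f h X B σ (a • V) - model f h X B σ 0 ≤ -(a₀ * d) := by
      rw [hd] at h3 ⊢; linarith
    have h5 := mul_le_mul_of_nonneg_left h4 hη.le
    linarith
  have hCpos : 0 < 1 / lam + 2 * c / κ₁ := by positivity
  set C := 1 / lam + 2 * c / κ₁
  have hθ : 0 < η * a₀ := mul_pos hη ha₀
  rw [div_mul_eq_mul_div, le_div_iff₀ (by positivity)]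
  -- Adding C times the second bound to ηa₀ times the first eliminates d.
  have h1 := mul_le_mul_of_nonneg_left hnext2 hCpos.le
  have h2 := mul_le_mul_of_nonneg_left hnext hθ.le
  linarith

end Stationarity

end ARPQN

end

/-! ### Assembly of the theorem. -/

open ARPQN in
theorem mainTheorem2 {n r : ℕ} (P : ARPQN.Params)
    (f h : ARPQN.MatSpace n r → ℝ)
    (R : ARPQN.MatSpace n r → ARPQN.MatSpace n r → ARPQN.MatSpace n r)
    (hR : ARPQN.IsRetraction R)
    (M₂ : ℝ) (hM₂_pos : 0 < M₂)
    (hM₂ : ∀ X ∈ ARPQN.stiefel n r, ∀ ξ ∈ ARPQN.tangentSpace X,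
      ‖R X ξ - X - ξ‖ ≤ M₂ * ‖ξ‖ ^ 2)
    (s : ARPQN.Trace n r) (hs : ARPQN.IsRun P f h R s)
    (hf_diff : ContDiff ℝ 1 f) (L : ℝ≥0) (hf_lip : LipschitzWith L (gradient f))
    (hh_conv : ConvexOn ℝ Set.univ h) (Lh : ℝ≥0) (hh_lip : LipschitzWith Lh h)
    (κ₁ κ₂ : ℝ) (hκ₁ : 0 < κ₁) (hκ₁₂ : κ₁ < κ₂)
    (hB : ∀ (k : ℕ) (V : ARPQN.tangentSpace (s.X k)),
      κ₁ * ‖V‖ ^ 2 ≤ inner ℝ (s.B k V) V ∧ inner ℝ (s.B k V) V ≤ κ₂ * ‖V‖ ^ 2)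
    (hV : ∀ k i : ℕ, s.Reached P f h R k i → ‖s.V k i‖ ≠ 0)
    (hf_two : ContDiff ℝ 2 f)
    (Xstar : ARPQN.MatSpace n r) (hacc : MapClusterPt Xstar Filter.atTop s.X)
    (δ : ℝ) (hδ : 5 * (Lh : ℝ) * M₂ < δ)
    (hHess : ARPQN.LambdaMinGE
      (ARPQN.hessian
        (fun ξ : ARPQN.tangentSpace Xstar => f (R Xstar (ξ : ARPQN.MatSpace n r))) 0) δ) :
    Filter.Tendsto s.X Filter.atTop (𝓝 Xstar) ∧
      ∃ K : ℕ, 0 < K ∧ ∃ τ : ℝ, 0 < τ ∧ τ < 1 ∧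
        ∀ k : ℕ, K ≤ k →
          (f + h) (s.X k) - (f + h) Xstar ≤
            τ ^ (k - K) *
              (ARPQN.windowMax (f + h) s.X P.memory K - (f + h) Xstar) := by 
  have hB1 : ∀ (k : ℕ) (V : tangentSpace (s.X k)), κ₁ * ‖V‖ ^ 2 ≤ inner ℝ (s.B k V) V :=
    fun k V => (hB k V).1
  have hfd : Differentiable ℝ f := hf_two.differentiable (by norm_num)
  obtain ⟨c, hc0, hc⟩ := hR.exists_objective_le hM₂_pos hM₂ hfd hf_lip hh_lip
  obtain ⟨M₁, hM₁, hRM⟩ := hR.exists_norm_sub_le hM₂_pos hM₂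
  obtain ⟨CF, hCF, hFlip⟩ := hR.exists_abs_objective_sub_le hM₂_pos hM₂ hfd hf_lip hh_lip
  obtain ⟨C, hC, hgrad⟩ := exists_norm_gradient_le (n := n) (r := r) hf_lip
  have hmem : ∀ k, s.X k ∈ stiefel n r := fun k =>
    (hs.mem_stiefel_and_σ_le hR hh_conv hB1 hκ₁ hc0 hc hV k).1
  choose V a σ ha ha1 hσ0 hσ1 hmin hXn hls hacc_dec using
    hs.exists_step hR hh_conv hB1 hκ₁ hc0 hc hV
  have hγ0 := P.lsγ_pos
  have hη0 := P.η₁_pos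
  have hlsσ := P.lsσ_pos
  have ha₀ : 0 < min 1 (P.lsγ * (κ₁ / (2 * c))) := by positivity
  set a₀ := min 1 (P.lsγ * (κ₁ / (2 * c)))
  set σmax := max P.σ₀ (P.γ₂ * (2 * c))
  have hσmax : 0 < σmax := (hσ0 0).trans_le (hσ1 0)
  have ha0 : ∀ k, 0 < a k := fun k => ha₀.trans_le (ha k)
  have hlow : ∀ k W, κ₁ * ‖W‖ ^ 2 ≤ modelCurv (s.B k) (σ k) W := fun k W => by
    have := mul_nonneg (hσ0 k).le (sq_nonneg ‖W‖)
    rw [modelCurv]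
    linarith [hB1 k W]
  have hup : ∀ k W, modelCurv (s.B k) (σ k) W ≤ (κ₂ + σmax) * ‖W‖ ^ 2 := fun k W => by
    have := mul_le_mul_of_nonneg_right (hσ1 k) (sq_nonneg ‖W‖)
    rw [modelCurv]
    linarith [(hB k W).2]
  have hA : 0 < κ₂ + σmax := by linarith
  have hstepn : ∀ k, ‖a k • (V k : MatSpace n r)‖ ≤ ‖V k‖ := fun k => by
    rw [norm_smul, Real.norm_of_nonneg (ha0 k).le]
    exact mul_le_of_le_one_left (norm_nonneg _) (ha1 k)
  -- the values converge and the steps vanish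
  obtain ⟨l, hFl, hV0⟩ := exists_tendsto_of_window_decrease (F := f + h) (X := s.X)
    (m := P.memory) (v := fun k => ‖V k‖) (fun k => norm_nonneg _)
    (c := 1 / 2 * P.lsσ * a₀ * κ₁) (C := CF) (by positivity)
    (fun k => (hls k).trans <| by
      have h1 : a₀ * (κ₁ * ‖V k‖ ^ 2) ≤ a k * inner ℝ (s.B k (V k)) (V k) :=
        mul_le_mul (ha k) (hB1 k _) (by positivity) (ha0 k).le
      have h2 := mul_le_mul_of_nonneg_left h1 hlsσ.le
      linarith)
    (fun k => by
      rw [hXn k]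
      exact (hFlip _ (hmem k) _ (a k • V k).2).trans
        (mul_le_mul_of_nonneg_left (hstepn k) hCF.le))
    (by
      have hcont : ContinuousOn (f + h) (stiefel n r) :=
        (hf_two.continuous.add hh_lip.continuous).continuousOn
      refine (isCompact_stiefel.bddBelow_image hcont).mono ?_
      rintro _ ⟨k, rfl⟩
      exact ⟨s.X k, hmem k, rfl⟩)
  obtain ⟨ψ, hψ, hψX⟩ := hacc.tendsto_subseq
  have hXs : Xstar ∈ stiefel n r :=
    isClosed_stiefel.mem_of_tendsto hψX (Filter.Eventually.of_forall fun k => hmem _)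
  have hl : l = (f + h) Xstar := by
    refine tendsto_nhds_unique (hFl.comp hψ.tendsto_atTop) ?_
    exact ((hf_two.continuous.add hh_lip.continuous).tendsto Xstar).comp hψX
  rw [hl] at hFl
  -- the accumulation point is stationary
  have hstat : ∀ ζ : tangentSpace Xstar, 0 ≤ inner ℝ (gradient f Xstar) (ζ : MatSpace n r)
      + h (Xstar + ζ) - h Xstar := fun ζ => by
    refine nonneg_of_nonneg_add_sq hh_conv (A := κ₂ + σmax) fun t => ?_
    -- The projections of tζ onto the tangent spaces at X_ψ(k) are the test vectors; they converge
    -- to tζ.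
    have hproj := continuous_tangentProj (t • (ζ : MatSpace n r))
    have hcont : Continuous fun X : MatSpace n r =>
        inner ℝ (gradient f X) (tangentProj X (t • (ζ : MatSpace n r)))
        + 1 / 2 * (κ₂ + σmax) * ‖tangentProj X (t • (ζ : MatSpace n r))‖ ^ 2
        + (h (X + tangentProj X (t • (ζ : MatSpace n r))) - h X) :=
      ((hf_lip.continuous.inner hproj).add (continuous_const.mul (hproj.norm.pow 2))).add
        ((hh_lip.continuous.comp (continuous_id.add hproj)).sub hh_lip.continuous)
    have hlim := (hcont.tendsto Xstar).comp hψX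
    rw [tangentProj_eq_self (Submodule.smul_mem _ t ζ.2)] at hlim
    have hzero : Filter.Tendsto (fun k => -((C + Lh) * ‖V (ψ k)‖)) Filter.atTop (𝓝 0) := by
      simpa using ((hV0.comp hψ.tendsto_atTop).const_mul (C + (Lh : ℝ))).neg
    refine le_of_tendsto_of_tendsto' hzero hlim fun k => ?_
    exact neg_le_of_isMin_model hh_lip (hgrad _ (hmem _)) (hmin _)
      ((by positivity : 0 ≤ κ₁ * ‖V (ψ k)‖ ^ 2).trans (hlow _ _))
      (W := ⟨tangentProj (s.X (ψ k)) (t • (ζ : MatSpace n r)), tangentProj_mem (hmem _) _⟩)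
      (hup _ _)
  have hδ' : 2 * (Lh : ℝ) * M₂ < δ := by
    have : 0 ≤ (Lh : ℝ) * M₂ := by positivity
    linarith
  obtain ⟨c₂, hc₂, hloc⟩ := hR.exists_local_bounds hM₂ hf_two hh_lip hXs hδ' hHess
  have hconv : Filter.Tendsto s.X Filter.atTop (𝓝 Xstar) := by
    refine tendsto_of_quadratic_growth (F := f + h) (S := stiefel n r) (c := c₂ / 4)
      (by positivity) ?_ hmem hacc hFl ?_
    · filter_upwards [hloc] with X hX hXm
      obtain ⟨ζ, W, -, h1, -, h2⟩ := hX hXm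
      have h3 := hstat ζ
      have h4 : ‖X - Xstar‖ ^ 2 ≤ 4 * ‖ζ‖ ^ 2 := by nlinarith [norm_nonneg (X - Xstar)]
      have h5 := mul_le_mul_of_nonneg_left h4 hc₂.le
      linarith
    · have h1 : Filter.Tendsto (fun k => M₁ * ‖V k‖) Filter.atTop (𝓝 0) := by
        simpa using hV0.const_mul M₁
      refine squeeze_zero (fun k => norm_nonneg _) (fun k => ?_) h1
      rw [hXn k]
      exact (hRM _ (hmem k) _ (a k • V k).2).trans (mul_le_mul_of_nonneg_left (hstepn k) hM₁.le)
  refine ⟨hconv, ?_⟩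
  obtain ⟨N, hN⟩ := Filter.eventually_atTop.1 (hconv.eventually hloc)
  -- linear rate
  obtain ⟨lam, hlam0, hlam1, hlamA⟩ : ∃ lam : ℝ, 0 < lam ∧ lam ≤ 1 ∧
      2 * lam * (κ₂ + σmax) ≤ c₂ := by
    refine ⟨min 1 (c₂ / (2 * (κ₂ + σmax))), by positivity, min_le_left _ _, ?_⟩
    have h1 := min_le_right 1 (c₂ / (2 * (κ₂ + σmax)))
    rw [le_div_iff₀ (by positivity)] at h1
    linarith
  have hCpos : 0 < 1 / lam + 2 * c / κ₁ := by positivity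
  have hθ : 0 < P.η₁ * a₀ := by positivity
  -- K is `N + 1` because K must be positive; nonnegativity comes from growth together with
  -- stationarity.
  have hnn : 0 ≤ windowMax (f + h) s.X P.memory (N + 1) - (f + h) Xstar := by
    obtain ⟨ζ, W, -, -, -, h2⟩ := hN (N + 1) (Nat.le_succ N) (hmem _)
    have h3 := hstat ζ
    have h4 := le_windowMax (f + h) s.X (Nat.sub_le (N + 1) P.memory) le_rfl
    have h5 : 0 ≤ c₂ * ‖ζ‖ ^ 2 := by positivity
    linarith
  obtain ⟨τ, hτ0, hτ1, hτ⟩ := exists_rate_of_window_contraction (F := f + h) (X := s.X)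
    (m := P.memory) (a := (f + h) Xstar) (K := N + 1)
    (τ₀ := (1 / lam + 2 * c / κ₁) / ((1 / lam + 2 * c / κ₁) + P.η₁ * a₀))
    (by positivity) ((div_lt_one (by positivity)).2 (by linarith)) hnn
    (fun k hk => by
      obtain ⟨ζ, W, hW, -, hWm, -⟩ := hN k ((Nat.le_succ N).trans hk) (hmem _)
      rw [hXn k]
      refine objective_contraction hh_conv hc hc0 (hmem k) hκ₁ hη0 (hlow k) (hup k) (hmin k)
        ha₀ (ha k) (ha1 k) hlam0 hlam1 hA.le hlamA hW hWm ?_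
      rw [← hXn k]
      exact hacc_dec k)
  exact ⟨N + 1, Nat.succ_pos N, τ, hτ0, hτ1, hτ⟩
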